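/- **Setting.** Let $\Delta>0$, let $n,m,q$ be positive integers, let $\mathcal C^d=C([-\Delta,0];\mathbb R^d)$ with the supremum norm $\|\cdot\|_\infty$ built on the Euclidean norm $|\cdot|$, and let $\mathcal C^d_\rho=\{\phi\in\mathcal C^d:\|\phi\|_\infty\le\rho\}$. For a function $x$ put $x_t(\theta)=x(t+\theta)$, $\theta\in[-\Delta,0]$. Let $f:\mathcal C^n\times\mathbb R^m\to\mathbb R^n$, $h:\mathcal C^n\to\mathbb R^q$, $\widehat f:\mathcal C^n\times\mathbb R^m\times\mathbb R^q\to\mathbb R^n$ and $k:\mathcal C^n\times\mathbb R^q\to\mathbb R^m$ be Lipschitz on bounded sets, with $f(0,0)=0$, $h(0)=0$, $\widehat f(0,0,0)=0$, $k(0,0)=0$. They describe the plant $\dot x(t)=f(x_t,u(t))$, $y(t)=h(x_t)$, and the observer-based controller $\dot{\hat x}(t)=\widehat f(\hat x_t,u(t),y(t))$, $u(t)=k(\hat x_t,y(t))$. For $\tilde\phi=(\tilde\phi_1,\tilde\phi_2)\in\mathcal C^{2n}$ and $\tilde u=(\tilde u_1,\tilde u_2)\in\mathbb R^{m}\times\mathbb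 R^n$ let $$F(\tilde\phi)=\begin{bmatrix}f(\tilde\phi_1,k(\tilde\phi_2,h(\tilde\phi_1)))\\ \widehat f(\tilde\phi_2,k(\tilde\phi_2,h(\tilde\phi_1)),h(\tilde\phi_1))\end{bmatrix},\qquad \widetilde F(\tilde\phi,\tilde u)=\begin{bmatrix}f(\tilde\phi_1,\tilde u_1)\\ \tilde u_2\end{bmatrix}.$$ For $V:\mathcal C^{2n}\to\mathbb R^+=[0,\infty)$ and $v\in\mathbb R^{2n}$ let $D^+_vV(\phi)=\limsup_{\tau\to0^+}\frac{V(\phi_{\tau,v})-V(\phi)}{\tau}\in[-\infty,+\infty]$, where $\phi_{\tau,v}(s)=\phi(s+\tau)$ for $s\in[-\Delta,-\tau)$ and $\phi_{\tau,v}(s)=\phi(0)+(s+\tau)v$ for $s\in[-\tau,0]$. A continuous $\gamma:\mathbb R^+\to\mathbb R^+$ is of class $\mathcal K$ if $\gamma(0)=0$ and $\gamma$ is strictly increasing, and of class $\mathcal K_\infty$ if it is moreover unbounded. **Assumption.** There exist $V:\mathcal C^{2n}\to\mathbb R^+$, a $C^1$ function $V_1:\mathbb R^{2n}\to\mathbb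 R^+$ with locally Lipschitz derivative, a locally Lipschitz $V_2:\mathcal C^{2n}\to\mathbb R^+$, functions $\beta_1,\beta_2,\gamma_1,\gamma_2$ of class $\mathcal K_\infty$, reals $\eta,\mu>0$, a $C^1$ function $p:\mathbb R^+\to\mathbb R^+$ of class $\mathcal K_\infty$ with locally Lipschitz derivative, $\nu\in\{0,1\}$, and $\alpha_3$ of class $\mathcal K$ such that, for all $\tilde\phi\in\mathcal C^{2n}$, * $V(\tilde\phi)=V_1(\tilde\phi(0))+V_2(\tilde\phi)$ and $\beta_1(|\tilde\phi(0)|)\le V_1(\tilde\phi(0))\le\beta_2(|\tilde\phi(0)|)$; * $\gamma_1(|\tilde\phi(0)|)\le V(\tilde\phi)\le\gamma_2(\|\tilde\phi\|_\infty)$ and $D^+_{F(\tilde\phi)}V(\tilde\phi)\le-\alpha_3(|\tilde\phi(0)|)$; * $\nu D^+_{F(\tilde\phi)}V(\tilde\phi)+\eta D^+_{F(\tilde\phi)}[p\circ V_1](\tilde\phi)+\eta\mu\,p(V_1(\tilde\phi(0)))\le0$, where $[p\circ V_1](\tilde\phi)=p(V_1(\tilde\phi(0)))$; and the map $(\tilde\phi,\tilde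 u)\mapsto D^+_{\widetilde F(\tilde\phi,\tilde u)}V_2(\tilde\phi)$ is finite and Lipschitz on bounded subsets of $\mathcal C^{2n}\times\mathbb R^{m+n}$. **Theorem 1.** Let the Assumption hold, and let $\tilde q>0$ and $a\in(0,1]$. For all reals $0<r<R$ there exist positive reals $\delta,T,E$ such that the following holds for every sequence $0=t_0<t_1<\cdots$ with $t_j\to\infty$ and $a\delta\le t_{j+1}-t_j\le\delta$ for all $j$, and for all absolutely continuous $x_0,\hat x_0:[-\Delta,0]\to\mathbb R^n$ with $\operatorname{ess\,sup}|\dot x_0|\le\tilde q/\sqrt2$, $\operatorname{ess\,sup}|\dot{\hat x}_0|\le\tilde q/\sqrt2$ and $(x_0,\hat x_0)\in\mathcal C^{2n}_R$. The sampled-data closed loop with initial states $x_0,\hat x_0$, $$\dot x(t)=f\big(x_t,k(\hat x_{t_j},h(x_{t_j}))\big)\quad\text{for a.e. }t\in[t_j,t_{j+1}),$$ $$\hat x(t_{j+1})=\hat x(t_j)+(t_{j+1}-t_j)\,\widehat f\big(\hat x_{t_j},k(\hat x_{t_j},h(x_{t_j})),h(x_{t_j})\big),\qquad j=0,1,\dots,$$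 where $x$ is continuous on its domain and locally absolutely continuous for $t\ge0$, and where, for $\theta\in[-\Delta,0]$, $\hat x_{t_j}(\theta)=\hat x_0(t_j+\theta)$ if $t_j+\theta\le0$ and $$\hat x_{t_j}(\theta)=\hat x(t_l)+\frac{t_j+\theta-t_l}{t_{l+1}-t_l}\big(\hat x(t_{l+1})-\hat x(t_l)\big),\quad t_l=\max\{t_i:t_i\le t_j+\theta\},\quad\text{if }t_j+\theta>0,$$ has a solution on the whole of $[0,\infty)$; this solution is unique, in the sense that every solution on an interval $[0,b)$, $0<b\le\infty$, is a restriction of it; and it satisfies $$\begin{bmatrix}x_t\\ \hat x_{t_j}\end{bmatrix}\in\mathcal C^{2n}_E\quad\forall t\ge0,\ \forall j,\qquad\begin{bmatrix}x_t\\ \hat x_{t_j}\end{bmatrix}\in\mathcal C^{2n}_r\quad\forall t\ge T,\ \forall j\text{ with }t_j\ge T.$$ -/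

import Mathlib

open Set Filter Topology MeasureTheory

noncomputable section

namespace EulerEmulation

/-- The real Euclidean space of dimension `d`. -/
abbrev Eu (d : ℕ) : Type := EuclideanSpace ℝ (Fin d)

/-- The Euclidean space `ℝ²ⁿ`; the first `n` coordinates are indexed by `Sum.inl`, the last `n`
coordinates by `Sum.inr`. -/
abbrev Eu2 (n : ℕ) : Type := EuclideanSpace ℝ (Fin n ⊕ Fin n)

/-- The column vector `(v, w)` of `ℝ²ⁿ`. -/
def stack {n : ℕ} (v w : Eu n) : Eu2 n := WithLp.toLp 2 (Sum.elim v w)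

/-- The first block of a vector of `ℝ²ⁿ`. -/
def topBlock {n : ℕ} (v : Eu2 n) : Eu n := WithLp.toLp 2 fun i => v (Sum.inl i)

/-- The second block of a vector of `ℝ²ⁿ`. -/
def botBlock {n : ℕ} (v : Eu2 n) : Eu n := WithLp.toLp 2 fun i => v (Sum.inr i)

/-- The space of continuous functions from `[-Δ, 0]` to `E`, with the supremum norm. -/
abbrev Hist (Δ : ℝ) (E : Type) [TopologicalSpace E] : Type := C(Icc (-Δ) (0 : ℝ), E)

instance factLe (Δ : ℝ) [hΔ : Fact (0 < Δ)] : Fact (-Δ ≤ (0 : ℝ)) :=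
  ⟨by linarith [hΔ.out]⟩

/-- The point `0` of `[-Δ, 0]`. -/
def zeroPt (Δ : ℝ) [hΔ : Fact (0 < Δ)] : Icc (-Δ) (0 : ℝ) :=
  ⟨0, by linarith [hΔ.out], le_rfl⟩

/-! ### Comparison functions and regularity classes -/

/-- Class `𝒦`: functions on `[0, ∞)` that are continuous, zero at zero and strictly increasing
(only the values on `[0, ∞)` matter). -/
def IsClassK (γ : ℝ → ℝ) : Prop :=
  ContinuousOn γ (Ici 0) ∧ γ 0 = 0 ∧ StrictMonoOn γ (Ici 0)

/-- Class `𝒦_∞`: unbounded functions of class `𝒦`. -/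
def IsClassKInfty (γ : ℝ → ℝ) : Prop :=
  IsClassK γ ∧ ¬ BddAbove (γ '' Ici 0)

/-- Continuously differentiable functions on `[0, ∞)` (one-sided derivative at `0`)
with locally Lipschitz derivative. -/
def IsC1LOnNonneg (p : ℝ → ℝ) : Prop :=
  ∃ p' : ℝ → ℝ, (∀ s ∈ Ici (0 : ℝ), HasDerivWithinAt p (p' s) (Ici 0) s) ∧
    LocallyLipschitzOn (Ici 0) p'

/-- Lipschitz on bounded sets. -/
def LipschitzOnBounded {X Y : Type} [PseudoMetricSpace X] [PseudoMetricSpace Y]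
    (g : X → Y) : Prop :=
  ∀ S : Set X, Bornology.IsBounded S → ∃ K : NNReal, LipschitzOnWith K g S

/-! ### The derivative in Driver's form -/

section Driver

variable {Δ : ℝ} [hΔ : Fact (0 < Δ)] {E : Type} [NormedAddCommGroup E] [NormedSpace ℝ E]

/-- For a velocity `v`, the function equal to `φ (s + h)` for `s ∈ [-Δ, -h)` and to
`φ 0 + (s + h) v` for `s ∈ [-h, 0]` (used for `0 ≤ h < Δ`; `IccExtendCM φ` extends `φ` to the
real line by constants and serves to write `φ (s + h)`). -/
def driverShift (φ : Hist Δ E) (h : ℝ) (v : E) : Hist Δ E where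
  toFun s := if (s : ℝ) < -h then ContinuousMap.IccExtendCM φ ((s : ℝ) + h)
    else φ (zeroPt Δ) + ((s : ℝ) + h) • v
  continuous_toFun := by
    have h0 : ContinuousMap.IccExtendCM φ (0 : ℝ) = φ (zeroPt Δ) :=
      ContinuousMap.IccExtendCM_of_mem (f := φ) (zeroPt Δ).2
    have e : (fun s : Icc (-Δ) (0 : ℝ) =>
        if (s : ℝ) < -h then ContinuousMap.IccExtendCM φ ((s : ℝ) + h)
        else φ (zeroPt Δ) + ((s : ℝ) + h) • v) =
        fun s : Icc (-Δ) (0 : ℝ) => if -h ≤ (s : ℝ) then φ (zeroPt Δ) + ((s : ℝ) + h) • v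
          else ContinuousMap.IccExtendCM φ ((s : ℝ) + h) := by
      funext s
      by_cases hs : (s : ℝ) < -h
      · simp [hs, not_le.mpr hs]
      · simp [hs, not_lt.mp hs]
    rw [e]
    refine Continuous.if_le (by fun_prop) (by fun_prop) (by fun_prop) (by fun_prop) ?_
    intro s hs
    have hz : (s : ℝ) + h = 0 := by rw [← hs]; ring
    rw [hz, h0, zero_smul, add_zero]

/-- `D⁺V (φ, u) = limsup_{h → 0⁺} (V φ_{h,u} - V φ) / h`, in the extended reals, with respect to a
system `ẋ(t) = G (x_t, u(t))`; here `v = G (φ, u)` is the velocity. -/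
def driverDeriv (V : Hist Δ E → ℝ) (φ : Hist Δ E) (v : E) : EReal :=
  limsup (fun h : ℝ => (((V (driverShift φ h v) - V φ) / h : ℝ) : EReal)) (𝓝[>] 0)

/-- `V` is smoothly separable, with the decomposition `V φ = V₁ (φ 0) + V₂ φ`
and the bounds `β₁ |φ 0| ≤ V₁ (φ 0) ≤ β₂ |φ 0|`. -/
structure SmoothlySeparable (V : Hist Δ E → ℝ) (V₁ : E → ℝ) (V₂ : Hist Δ E → ℝ)
    (β₁ β₂ : ℝ → ℝ) : Prop where
  V₁_nonneg : ∀ v, 0 ≤ V₁ v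
  V₁_contDiff : ContDiff ℝ 1 V₁
  V₁_lipschitz : LocallyLipschitz (fderiv ℝ V₁)
  V₂_nonneg : ∀ φ, 0 ≤ V₂ φ
  V₂_lipschitz : LocallyLipschitz V₂
  β₁_class : IsClassKInfty β₁
  β₂_class : IsClassKInfty β₂
  split : ∀ φ, V φ = V₁ (φ (zeroPt Δ)) + V₂ φ
  bounds : ∀ φ : Hist Δ E,
    β₁ ‖φ (zeroPt Δ)‖ ≤ V₁ (φ (zeroPt Δ)) ∧ V₁ (φ (zeroPt Δ)) ≤ β₂ ‖φ (zeroPt Δ)‖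

end Driver

/-! ### Pairs of histories, the closed-loop system and the extended open-loop system -/

section System

variable {Δ : ℝ} {n m q : ℕ}

/-- The function `θ ↦ (φ θ, ψ θ)`. -/
def pairHist (φ ψ : Hist Δ (Eu n)) : Hist Δ (Eu2 n) where
  toFun θ := stack (φ θ) (ψ θ)
  continuous_toFun := by
    refine (PiLp.continuous_toLp 2 _).comp (continuous_pi fun i => ?_)
    rcases i with i | i <;> simp only [Sum.elim_inl, Sum.elim_inr] <;> fun_prop

/-- First component of a function with values in `ℝ²ⁿ`. -/
def fstHist (φ : Hist Δ (Eu2 n)) : Hist Δ (Eu n) where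
  toFun θ := topBlock (φ θ)
  continuous_toFun := (PiLp.continuous_toLp 2 _).comp (continuous_pi fun i => by fun_prop)

/-- Second component of a function with values in `ℝ²ⁿ`. -/
def sndHist (φ : Hist Δ (Eu2 n)) : Hist Δ (Eu n) where
  toFun θ := botBlock (φ θ)
  continuous_toFun := (PiLp.continuous_toLp 2 _).comp (continuous_pi fun i => by fun_prop)

/-- The right-hand side `F` of the closed loop of plant and observer. -/
def closedLoop (f : Hist Δ (Eu n) × Eu m → Eu n) (hout : Hist Δ (Eu n) → Eu q)
    (fhat : Hist Δ (Eu n) × Eu m × Eu q → Eu n) (k : Hist Δ (Eu n) × Eu q → Eu m)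
    (φ : Hist Δ (Eu2 n)) : Eu2 n :=
  let y := hout (fstHist φ)
  let u := k (sndHist φ, y)
  stack (f (fstHist φ, u)) (fhat (sndHist φ, u, y))

/-- The right-hand side `(f (φ₁, u₁), u₂)` of the system with the inputs `u₁ ∈ ℝᵐ` (of the plant)
and `u₂ ∈ ℝⁿ` (velocity of the observer state). -/
def openLoop (f : Hist Δ (Eu n) × Eu m → Eu n) (φ : Hist Δ (Eu2 n)) (u : Eu m × Eu n) : Eu2 n :=
  stack (f (fstHist φ, u.1)) u.2

/-- The standing Lyapunov–Krasovskii assumption on the closed loop. -/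
def LyapunovAssumption [Fact (0 < Δ)]
    (f : Hist Δ (Eu n) × Eu m → Eu n) (hout : Hist Δ (Eu n) → Eu q)
    (fhat : Hist Δ (Eu n) × Eu m × Eu q → Eu n) (k : Hist Δ (Eu n) × Eu q → Eu m) : Prop :=
  ∃ (V : Hist Δ (Eu2 n) → ℝ) (V₁ : Eu2 n → ℝ) (V₂ : Hist Δ (Eu2 n) → ℝ)
    (β₁ β₂ γ₁ γ₂ p α₃ : ℝ → ℝ) (η μ ν : ℝ),
    SmoothlySeparable V V₁ V₂ β₁ β₂ ∧
    IsClassKInfty γ₁ ∧ IsClassKInfty γ₂ ∧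
    0 < η ∧ 0 < μ ∧
    IsC1LOnNonneg p ∧ IsClassKInfty p ∧
    (ν = 0 ∨ ν = 1) ∧
    IsClassK α₃ ∧
    (∀ φ, γ₁ ‖φ (zeroPt Δ)‖ ≤ V φ ∧ V φ ≤ γ₂ ‖φ‖) ∧
    (∀ φ, driverDeriv V φ (closedLoop f hout fhat k φ) ≤ ((-α₃ ‖φ (zeroPt Δ)‖ : ℝ) : EReal)) ∧
    (∀ φ, (ν : EReal) * driverDeriv V φ (closedLoop f hout fhat k φ)
        + (η : EReal) * driverDeriv (fun ψ => p (V₁ (ψ (zeroPt Δ)))) φ (closedLoop f hout fhat k φ)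
        + ((η * μ * p (V₁ (φ (zeroPt Δ))) : ℝ) : EReal) ≤ 0) ∧
    (∃ g : Hist Δ (Eu2 n) × (Eu m × Eu n) → ℝ,
      (∀ φ u, driverDeriv V₂ φ (openLoop f φ u) = (g (φ, u) : EReal)) ∧
      LipschitzOnBounded g)

end System

/-! ### Initial states, partitions and the sampled-data closed loop -/

/-- `φ ∈ W^{1,∞}` (absolutely continuous with essentially bounded derivative) and
`ess sup |dφ/dθ| ≤ L`. -/
def W1InftyBound {Δ : ℝ} [Fact (0 < Δ)] {n : ℕ} (φ : Hist Δ (Eu n)) (L : ℝ) : Prop :=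
  AbsolutelyContinuousOnInterval (ContinuousMap.IccExtendCM φ) (-Δ) 0 ∧
    ∀ᵐ θ ∂(volume.restrict (Icc (-Δ) (0 : ℝ))), ‖deriv (ContinuousMap.IccExtendCM φ) θ‖ ≤ L

/-- Partitions `0 = t₀ < t₁ < ⋯`, `t_j → ∞`, of `[0, ∞)` with
`a δ ≤ t_{j+1} - t_j ≤ δ` for all `j`. -/
structure IsPartition (a δ : ℝ) (t : ℕ → ℝ) : Prop where
  zero : t 0 = 0
  strictMono : StrictMono t
  tendsto : Tendsto t atTop atTop
  dwell : ∀ j, a * δ ≤ t (j + 1) - t j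
  diam : ∀ j, t (j + 1) - t j ≤ δ

open Classical in
/-- A function of the real variable, restricted to `[-Δ, 0]`, as an element of `Hist Δ E`
(it is only used for functions that are continuous on `[-Δ, 0]`). -/
def toHist (Δ : ℝ) {E : Type} [NormedAddCommGroup E] (g : ℝ → E) : Hist Δ E :=
  if hg : ContinuousOn g (Icc (-Δ) 0) then ⟨(Icc (-Δ) (0 : ℝ)).domRestrict g, hg.domRestrict⟩ else 0

/-- The history `x_s`, `x_s θ = x (s + θ)`. -/
def hist (Δ : ℝ) {E : Type} [NormedAddCommGroup E] (x : ℝ → E) (s : ℝ) : Hist Δ E :=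
  toHist Δ fun θ => x (s + θ)

/-- Piecewise linear interpolation of the observer samples `z l` (the observer state at `t l`)
at the time `s`; the initial observer history is used for `s ≤ 0`. -/
def interp {Δ : ℝ} [Fact (0 < Δ)] {n : ℕ} (t : ℕ → ℝ) (xhat₀ : Hist Δ (Eu n)) (z : ℕ → Eu n)
    (s : ℝ) : Eu n :=
  if s ≤ 0 then ContinuousMap.IccExtendCM xhat₀ s
  else
    let l := sSup {l : ℕ | t l ≤ s}
    z l + ((s - t l) / (t (l + 1) - t l)) • (z (l + 1) - z l)

/-- The history of the interpolated observer state at the sampling time `t j`. -/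
def obsHist {Δ : ℝ} [Fact (0 < Δ)] {n : ℕ} (t : ℕ → ℝ) (xhat₀ : Hist Δ (Eu n)) (z : ℕ → Eu n)
    (j : ℕ) : Hist Δ (Eu n) :=
  hist Δ (interp t xhat₀ z) (t j)

/-- `(x, z)` solves, on the time interval `[0, b)`, the sampled-data closed loop with sampling
times `t j` and initial states `x₀`, `xhat₀`. Here `x` is the plant state (only its values on
`[-Δ, b)` matter) and `z j` is the observer state at time `t j`. -/
structure IsSampledSolution {Δ : ℝ} [Fact (0 < Δ)] {n m q : ℕ}
    (f : Hist Δ (Eu n) × Eu m → Eu n) (hout : Hist Δ (Eu n) → Eu q)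
    (fhat : Hist Δ (Eu n) × Eu m × Eu q → Eu n) (k : Hist Δ (Eu n) × Eu q → Eu m)
    (t : ℕ → ℝ) (x₀ xhat₀ : Hist Δ (Eu n)) (b : EReal)
    (x : ℝ → Eu n) (z : ℕ → Eu n) : Prop where
  init : ∀ θ : Icc (-Δ) (0 : ℝ), x θ = x₀ θ
  obs_init : z 0 = xhat₀ (zeroPt Δ)
  cont : ContinuousOn x {s : ℝ | -Δ ≤ s ∧ (s : EReal) < b}
  abs_cont : ∀ c : ℝ, 0 ≤ c → (c : EReal) < b → AbsolutelyContinuousOnInterval x 0 c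
  ode : ∀ j, ∀ᵐ s : ℝ, s ∈ Ico (t j) (t (j + 1)) → (s : EReal) < b →
    HasDerivAt x
      (f (hist Δ x s, k (obsHist t xhat₀ z j, hout (hist Δ x (t j))))) s
  euler : ∀ j, (t j : EReal) < b →
    z (j + 1) = z j + (t (j + 1) - t j) •
      fhat (obsHist t xhat₀ z j,
        k (obsHist t xhat₀ z j, hout (hist Δ x (t j))),
        hout (hist Δ x (t j)))

end EulerEmulation

end

/-! The Euler scheme is hidden in a delay equation. On `[t j, t (j+1))` the interpolated observer
state moves with the constant velocity computed at `t j`, so the pair `X` of plant state and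
interpolated observer state solves `X' = A (X_t, X_{σ(t)})`, where `A` is `sampledField`, `σ(t)` is
the last sampling time, and `A (φ, φ)` is the right-hand side of the continuous-time loop. The data
enter only through `A`, which is Lipschitz on bounded sets.

Stability is a perturbation argument. The Driver derivative of `V` at `φ` with velocity `A (φ, ψ)`
is bounded by a functional `G (φ, ψ)` that is Lipschitz on bounded sets and satisfies `G (φ, φ) ≤ -α
|φ 0|` (`LyapunovAssumption.exists_functional`). While `X` stays in a fixed ball it is Lipschitz
with a constant independent of the partition, so `X_{σ(t)}` is within a multiple of `δ` of `X_t`,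
and for small `δ` the Dini derivative of `V` along `X` is at most `-α |X(t)| + ε`.

This does not bound the derivative by a function of `V`, because `α` sees only the current value
`X(t)`. A window argument replaces such a bound (`PracticalDecay.window`). Either `|X|` stays below
a threshold `s` for a full delay length, which makes `V` small, or `|X|` exceeds `s` once, hence
`s/2` for a definite time, which costs `V` a fixed amount. So `V` falls below the level that
confines `X(t)` to the target ball, and never reaches the level of the boundary of the large ball.

To have a global solution before any bound is known, `A` is composed with a radial retraction, which
makes it bounded and globally Lipschitz. The truncated equation is solved by a contraction
(`exists_sampled_volterra`), and the decay estimate then shows that the truncation is never active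
(`exists_sampled_practical_stability`). Uniqueness is proved for the integral equation, to which the
sampled-data loop is equivalent. -/

namespace EulerEmulation

/-! ### Maps that are Lipschitz on bounded sets -/

namespace LipschitzOnBounded

variable {X Y Z : Type} [PseudoMetricSpace X] [PseudoMetricSpace Y] [PseudoMetricSpace Z]

theorem isBounded_image {g : X → Y} (hg : LipschitzOnBounded g) {S : Set X}
    (hS : Bornology.IsBounded S) : Bornology.IsBounded (g '' S) := by
  obtain ⟨K, hK⟩ := hg S hS
  obtain ⟨C, hC⟩ := Metric.isBounded_iff.1 hS
  refine Metric.isBounded_iff.2 ⟨K * C, ?_⟩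
  rintro _ ⟨x, hx, rfl⟩ _ ⟨y, hy, rfl⟩
  exact (hK.dist_le_mul x hx y hy).trans (by gcongr; exact hC hx hy)

theorem comp {g : Y → Z} {h : X → Y} (hg : LipschitzOnBounded g) (hh : LipschitzOnBounded h) :
    LipschitzOnBounded fun x => g (h x) := by
  intro S hS
  obtain ⟨K, hK⟩ := hh S hS
  obtain ⟨K', hK'⟩ := hg _ (hh.isBounded_image hS)
  exact ⟨K' * K, hK'.comp hK (mapsTo_image h S)⟩

theorem prodMk {g : X → Y} {h : X → Z} (hg : LipschitzOnBounded g) (hh : LipschitzOnBounded h) :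
    LipschitzOnBounded fun x => (g x, h x) := by
  intro S hS
  obtain ⟨K, hK⟩ := hg S hS
  obtain ⟨K', hK'⟩ := hh S hS
  exact ⟨max K K', hK.prodMk hK'⟩

theorem of_lipschitzWith {g : X → Y} {K : NNReal} (hg : LipschitzWith K g) :
    LipschitzOnBounded g := fun _ _ => ⟨K, hg.lipschitzOnWith⟩

theorem fst : LipschitzOnBounded fun x : X × Y => x.1 := of_lipschitzWith LipschitzWith.prod_fst

theorem snd : LipschitzOnBounded fun x : X × Y => x.2 := of_lipschitzWith LipschitzWith.prod_snd

theorem of_locallyLipschitz [ProperSpace X] {g : X → Y} (hg : LocallyLipschitz g) :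
    LipschitzOnBounded g := by
  intro S hS
  obtain ⟨K, hK⟩ := (hg.locallyLipschitzOn (s := closure S)).exists_lipschitzOnWith_of_compact
    hS.isCompact_closure
  exact ⟨K, hK.mono subset_closure⟩

theorem add {F : Type} [SeminormedAddCommGroup F] {g h : X → F} (hg : LipschitzOnBounded g)
    (hh : LipschitzOnBounded h) : LipschitzOnBounded fun x => g x + h x := by
  intro S hS
  obtain ⟨K, hK⟩ := hg S hS
  obtain ⟨K', hK'⟩ := hh S hS
  exact ⟨K + K', hK.add hK'⟩

/-- Product rule: both factors are bounded on bounded sets. It serves the term `DV₁(φ(0)) · A (φ,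
ψ)` of the derivative of `V`. -/
theorem clm_apply {F G : Type} [NormedAddCommGroup F] [NormedSpace ℝ F] [NormedAddCommGroup G]
    [NormedSpace ℝ G] {B : X → F →L[ℝ] G} {v : X → F} (hB : LipschitzOnBounded B)
    (hv : LipschitzOnBounded v) : LipschitzOnBounded fun x => B x (v x) := by
  intro S hS
  obtain ⟨K, hK⟩ := hB S hS
  obtain ⟨K', hK'⟩ := hv S hS
  obtain ⟨b, hb0, hb⟩ := (hB.isBounded_image hS).exists_pos_norm_le
  obtain ⟨c, hc0, hc⟩ := (hv.isBounded_image hS).exists_pos_norm_le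
  refine ⟨_, LipschitzOnWith.of_dist_le' (K := b * K' + K * c) fun x hx y hy => ?_⟩
  have h1 := hK.dist_le_mul x hx y hy
  have h2 := hK'.dist_le_mul x hx y hy
  have h3 : B x (v x) - B y (v y) = B x (v x - v y) + (B x - B y) (v y) := by
    simp
  rw [dist_eq_norm] at h1 h2 ⊢
  rw [h3]
  calc _ ≤ ‖B x‖ * ‖v x - v y‖ + ‖B x - B y‖ * ‖v y‖ :=
        (norm_add_le _ _).trans (add_le_add ((B x).le_opNorm _) ((B x - B y).le_opNorm _))
    _ ≤ b * (K' * dist x y) + K * dist x y * c := by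
        gcongr
        · exact hb _ ⟨x, hx, rfl⟩
        · exact hc _ ⟨y, hy, rfl⟩
    _ = _ := by ring

theorem continuous {F : Type} [SeminormedAddCommGroup F] {g : F → Y} (hg : LipschitzOnBounded g) :
    Continuous g := by
  refine continuous_iff_continuousAt.2 fun x => ?_
  obtain ⟨K, hK⟩ := hg (Metric.ball x 1) Metric.isBounded_ball
  exact hK.continuousOn.continuousAt (Metric.ball_mem_nhds x one_pos)

end LipschitzOnBounded

/-! ### Radial truncation -/

section Clamp

variable {F : Type} [NormedAddCommGroup F] [NormedSpace ℝ F]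

/-- The radial retraction onto the closed ball of radius `ρ`. -/
noncomputable def radialClamp (ρ : ℝ) (x : F) : F := (ρ / max ρ ‖x‖) • x

theorem radialClamp_of_norm_le {ρ : ℝ} (hρ : 0 < ρ) {x : F} (hx : ‖x‖ ≤ ρ) :
    radialClamp ρ x = x := by
  rw [radialClamp, max_eq_left hx, div_self hρ.ne', one_smul]

theorem norm_radialClamp_le {ρ : ℝ} (hρ : 0 < ρ) (x : F) : ‖radialClamp ρ x‖ ≤ ρ := by
  have h : 0 < max ρ ‖x‖ := lt_max_of_lt_left hρ
  rw [radialClamp, norm_smul, Real.norm_of_nonneg (by positivity), div_mul_eq_mul_div,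
    div_le_iff₀ h]
  gcongr
  exact le_max_right _ _

/-- The constant 2 holds in any normed space; the Hilbert-space argument for constant 1 does not
apply to the sup norm on histories. The difference splits into a contracted `x - y` and a change of
scaling factor, each at most `‖x - y‖`. -/
theorem lipschitzWith_radialClamp {ρ : ℝ} (hρ : 0 < ρ) :
    LipschitzWith 2 (radialClamp ρ : F → F) := by
  refine LipschitzWith.of_dist_le_mul fun x y => ?_
  have ha : 0 < max ρ ‖x‖ := lt_max_of_lt_left hρ
  have hb : 0 < max ρ ‖y‖ := lt_max_of_lt_left hρ
  have hab : |max ρ ‖y‖ - max ρ ‖x‖| ≤ ‖x - y‖ := by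
    rw [max_comm ρ, max_comm ρ]
    refine (abs_max_sub_max_le_abs _ _ _).trans ?_
    rw [norm_sub_rev]
    exact abs_norm_sub_norm_le _ _
  have e : radialClamp ρ x - radialClamp ρ y = (ρ / max ρ ‖x‖) • (x - y) +
      (ρ / max ρ ‖x‖ * ((max ρ ‖y‖ - max ρ ‖x‖) / max ρ ‖y‖)) • y := by
    have : ρ / max ρ ‖x‖ * ((max ρ ‖y‖ - max ρ ‖x‖) / max ρ ‖y‖) =
        ρ / max ρ ‖x‖ - ρ / max ρ ‖y‖ := by field_simp
    rw [this, radialClamp, radialClamp]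
    module
  have h1 : ρ / max ρ ‖x‖ ≤ 1 := (div_le_one ha).2 (le_max_left _ _)
  have h2 : ‖y‖ / max ρ ‖y‖ ≤ 1 := (div_le_one hb).2 (le_max_right _ _)
  rw [dist_eq_norm, dist_eq_norm, e]
  calc _ ≤ ρ / max ρ ‖x‖ * ‖x - y‖ +
        ρ / max ρ ‖x‖ * (|max ρ ‖y‖ - max ρ ‖x‖| / max ρ ‖y‖) * ‖y‖ := by
        refine (norm_add_le _ _).trans (le_of_eq ?_)
        rw [norm_smul, norm_smul, Real.norm_of_nonneg (by positivity), norm_mul,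
          Real.norm_of_nonneg (by positivity : 0 ≤ ρ / max ρ ‖x‖), norm_div,
          Real.norm_of_nonneg hb.le, Real.norm_eq_abs]
    _ = ρ / max ρ ‖x‖ * ‖x - y‖ +
        ρ / max ρ ‖x‖ * (|max ρ ‖y‖ - max ρ ‖x‖| * (‖y‖ / max ρ ‖y‖)) := by ring
    _ ≤ 1 * ‖x - y‖ + 1 * (‖x - y‖ * 1) := by gcongr
    _ = _ := by push_cast; ring

end Clamp

/-! ### Histories of continuous functions -/

section HistLemmas

variable {Δ : ℝ} {E : Type} [NormedAddCommGroup E]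

theorem hist_apply' {x : ℝ → E} {s : ℝ} (hx : ContinuousOn x (Icc (s - Δ) s))
    (θ : Icc (-Δ) (0 : ℝ)) : hist Δ x s θ = x (s + θ) := by
  have h : ContinuousOn (fun θ => x (s + θ)) (Icc (-Δ) 0) := by
    refine hx.comp (by fun_prop) fun θ hθ => ⟨?_, ?_⟩
    · linarith [hθ.1]
    · linarith [hθ.2]
  simp only [hist, toHist, dif_pos h]
  rfl

theorem hist_apply {x : ℝ → E} (hx : Continuous x) (s : ℝ) (θ : Icc (-Δ) (0 : ℝ)) :
    hist Δ x s θ = x (s + θ) := hist_apply' hx.continuousOn θ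

theorem hist_congr {x y : ℝ → E} {s : ℝ} (hx : ContinuousOn x (Icc (s - Δ) s))
    (h : EqOn x y (Icc (s - Δ) s)) : hist Δ x s = hist Δ y s := by
  ext θ
  have hθ : s + (θ : ℝ) ∈ Icc (s - Δ) s := ⟨by linarith [θ.2.1], by linarith [θ.2.2]⟩
  rw [hist_apply' hx, hist_apply' (hx.congr h.symm), h hθ]

/-- Over the compact interval the sup norm induces the compact-open topology, so currying `(s, θ) ↦
x (s + θ)` gives a continuous map. -/
theorem continuous_hist {x : ℝ → E} (hx : Continuous x) : Continuous (hist Δ x) := by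
  have : hist Δ x = ContinuousMap.curry
      (⟨fun p : ℝ × Icc (-Δ) (0 : ℝ) => x (p.1 + p.2), by fun_prop⟩) := by
    funext s
    ext θ
    rw [hist_apply hx]
    rfl
  rw [this]
  exact ContinuousMap.continuous _

theorem norm_hist_le {x : ℝ → E} (hx : Continuous x) {s ρ : ℝ} (hρ : 0 ≤ ρ)
    (h : ∀ σ ∈ Icc (s - Δ) s, ‖x σ‖ ≤ ρ) : ‖hist Δ x s‖ ≤ ρ := by
  refine (ContinuousMap.norm_le _ hρ).2 fun θ => ?_
  rw [hist_apply hx]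
  exact h _ ⟨by linarith [θ.2.1], by linarith [θ.2.2]⟩

theorem norm_hist_sub_le {x y : ℝ → E} (hx : Continuous x) (hy : Continuous y) {s ρ : ℝ}
    (hρ : 0 ≤ ρ) (h : ∀ σ ∈ Icc (s - Δ) s, ‖x σ - y σ‖ ≤ ρ) :
    ‖hist Δ x s - hist Δ y s‖ ≤ ρ := by
  refine (ContinuousMap.norm_le _ hρ).2 fun θ => ?_
  rw [ContinuousMap.sub_apply, hist_apply hx, hist_apply hy]
  exact h _ ⟨by linarith [θ.2.1], by linarith [θ.2.2]⟩

theorem dist_hist_le {x : ℝ → E} {L : NNReal} (hx : LipschitzWith L x) (s s' : ℝ) :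
    dist (hist Δ x s) (hist Δ x s') ≤ L * |s - s'| := by
  refine (ContinuousMap.dist_le (by positivity)).2 fun θ => ?_
  rw [hist_apply hx.continuous, hist_apply hx.continuous]
  refine (hx.dist_le_mul _ _).trans (le_of_eq ?_)
  rw [Real.dist_eq]
  ring_nf

variable [Fact (0 < Δ)]

theorem hist_zeroPt {x : ℝ → E} (hx : Continuous x) (s : ℝ) :
    hist Δ x s (zeroPt Δ) = x s := by
  rw [hist_apply hx]
  simp [zeroPt]

theorem IccExtendCM_coe (φ : Hist Δ E) (θ : Icc (-Δ) (0 : ℝ)) :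
    ContinuousMap.IccExtendCM φ (θ : ℝ) = φ θ :=
  ContinuousMap.IccExtendCM_of_mem θ.2

theorem norm_IccExtendCM_le (φ : Hist Δ E) (s : ℝ) : ‖ContinuousMap.IccExtendCM φ s‖ ≤ ‖φ‖ :=
  φ.norm_coe_le_norm _

end HistLemmas

/-! ### Partitions and their sampling functions -/

/-- The last index `l` with `t l ≤ s`. -/
noncomputable def lastIdx (t : ℕ → ℝ) (s : ℝ) : ℕ := sSup {l : ℕ | t l ≤ s}

/-- The last sampling time not after `s`. -/
noncomputable def lastSample (t : ℕ → ℝ) (s : ℝ) : ℝ := t (lastIdx t s)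

/-- A measurable right-continuous sampling function `σ` with delay at most `δ` on `[0, ∞)`. -/
structure IsSampler (δ : ℝ) (σ : ℝ → ℝ) : Prop where
  measurable : Measurable σ
  nonneg : ∀ s, 0 ≤ σ s
  le : ∀ s, 0 ≤ s → σ s ≤ s
  ge : ∀ s, 0 ≤ s → s - δ ≤ σ s
  eventually_eq : ∀ s, 0 ≤ s → ∀ᶠ s' in 𝓝[≥] s, σ s' = σ s

namespace IsPartition

variable {a δ : ℝ} {t : ℕ → ℝ} (ht : IsPartition a δ t)
include ht

theorem nonneg (j : ℕ) : 0 ≤ t j := ht.zero ▸ ht.strictMono.monotone (Nat.zero_le j)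

theorem lastIdx_eq {j : ℕ} {s : ℝ} (h1 : t j ≤ s) (h2 : s < t (j + 1)) : lastIdx t s = j := by
  have : {l : ℕ | t l ≤ s} = Iic j := by
    ext l
    simp only [mem_ofPred_eq, mem_Iic]
    constructor
    · intro hl
      by_contra! hlt
      linarith [ht.strictMono.monotone (Nat.succ_le_of_lt hlt)]
    · intro hl
      exact (ht.strictMono.monotone hl).trans h1
  rw [lastIdx, this, csSup_Iic]

theorem exists_mem_Ico {s : ℝ} (hs : 0 ≤ s) : ∃ j, t j ≤ s ∧ s < t (j + 1) := by
  obtain ⟨N, hN⟩ := (ht.tendsto.eventually_gt_atTop s).exists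
  classical
  have hex : ∃ j, s < t j := ⟨N, hN⟩
  have h0 : Nat.find hex ≠ 0 := fun h => by
    have := Nat.find_spec hex
    rw [h, ht.zero] at this
    linarith
  obtain ⟨j, hj⟩ := Nat.exists_eq_succ_of_ne_zero h0
  refine ⟨j, not_lt.1 (Nat.find_min hex (by omega)), ?_⟩
  have := Nat.find_spec hex
  rwa [hj] at this

/-- The supremum of the empty set in `ℕ` is 0. This value at negative times keeps `lastIdx` monotone
on the whole line, from which measurability of `lastSample` follows. -/
theorem lastIdx_of_neg {s : ℝ} (hs : s < 0) : lastIdx t s = 0 := by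
  have : {l : ℕ | t l ≤ s} = ∅ := by
    ext l
    simp only [mem_ofPred_eq, mem_empty_iff_false, iff_false]
    linarith [ht.nonneg l]
  rw [lastIdx, this, csSup_empty, bot_eq_zero]

theorem lastIdx_sample (j : ℕ) : lastIdx t (t j) = j :=
  ht.lastIdx_eq le_rfl (ht.strictMono j.lt_succ_self)

theorem lastIdx_mono : Monotone (lastIdx t) := by
  intro s s' hss
  rcases lt_or_ge s 0 with hs | hs
  · rw [ht.lastIdx_of_neg hs]
    exact Nat.zero_le _
  · obtain ⟨i, hi, hi'⟩ := ht.exists_mem_Ico hs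
    obtain ⟨j, hj, hj'⟩ := ht.exists_mem_Ico (hs.trans hss)
    rw [ht.lastIdx_eq hi hi', ht.lastIdx_eq hj hj']
    by_contra! hlt
    linarith [ht.strictMono.monotone (Nat.succ_le_of_lt hlt)]

theorem lastSample_eq {j : ℕ} {s : ℝ} (h1 : t j ≤ s) (h2 : s < t (j + 1)) :
    lastSample t s = t j := by
  rw [lastSample, ht.lastIdx_eq h1 h2]

theorem isSampler : IsSampler δ (lastSample t) where
  measurable := (ht.strictMono.monotone.comp ht.lastIdx_mono).measurable
  nonneg s := ht.nonneg _
  le s hs := by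
    obtain ⟨i, hi, hi'⟩ := ht.exists_mem_Ico hs
    rwa [ht.lastSample_eq hi hi']
  ge s hs := by
    obtain ⟨i, hi, hi'⟩ := ht.exists_mem_Ico hs
    rw [ht.lastSample_eq hi hi']
    linarith [ht.diam i]
  eventually_eq s hs := by
    obtain ⟨i, hi, hi'⟩ := ht.exists_mem_Ico hs
    filter_upwards [Ico_mem_nhdsGE hi'] with s' h
    rw [ht.lastSample_eq hi hi', ht.lastSample_eq (hi.trans h.1) h.2]

end IsPartition

/-! ### Sampled Volterra equations -/

section Volterra

variable {Δ : ℝ} {E : Type} [NormedAddCommGroup E]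
  {A : Hist Δ E × Hist Δ E → E} {σ : ℝ → ℝ} {X Y : ℝ → E}

theorem stronglyMeasurable_sampled (hA : Continuous A) (hσ : Measurable σ) (hX : Continuous X) :
    StronglyMeasurable fun u => A (hist Δ X u, hist Δ X (σ u)) :=
  hA.comp_stronglyMeasurable ((continuous_hist hX).stronglyMeasurable.prodMk
    ((continuous_hist hX).stronglyMeasurable.comp_measurable hσ))

theorem intervalIntegrable_sampled (hA : Continuous A) {M : ℝ} (hσ : Measurable σ)
    (hX : Continuous X) (hM : ∀ u, ‖A (hist Δ X u, hist Δ X (σ u))‖ ≤ M) (b c : ℝ) :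
    IntervalIntegrable (fun u => A (hist Δ X u, hist Δ X (σ u))) volume b c :=
  (intervalIntegrable_const (c := M)).mono_fun
    (stronglyMeasurable_sampled hA hσ hX).aestronglyMeasurable
    (Eventually.of_forall fun u => (hM u).trans (Real.le_norm_self M))

theorem continuousWithinAt_sampled (hA : Continuous A) (hX : Continuous X) {S : Set ℝ} {t : ℝ}
    (h : ∀ᶠ u in 𝓝[S] t, σ u = σ t) :
    ContinuousWithinAt (fun u => A (hist Δ X u, hist Δ X (σ u))) S t := by
  have h1 : ContinuousWithinAt (fun u => A (hist Δ X u, hist Δ X (σ t))) S t :=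
    (hA.comp ((continuous_hist hX).prodMk continuous_const)).continuousWithinAt
  refine h1.congr_of_eventuallyEq ?_ rfl
  filter_upwards [h] with u hu
  rw [hu]

variable [NormedSpace ℝ E]

theorem integral_exp_mul_le {l : ℝ} (hl : 0 < l) (C s : ℝ) (hC : 0 ≤ C) :
    ∫ u in (0 : ℝ)..s, C * Real.exp (l * u) ≤ C / l * Real.exp (l * s) := by
  have h : ∀ u ∈ uIcc 0 s, HasDerivAt (fun u => C / l * Real.exp (l * u))
      (C * Real.exp (l * u)) u := by
    intro u _
    have := (((hasDerivAt_id u).const_mul l).exp).const_mul (C / l)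
    refine this.congr_deriv ?_
    simp only [id]
    field_simp
  rw [intervalIntegral.integral_eq_sub_of_hasDerivAt h
    (Continuous.intervalIntegrable (by fun_prop) _ _)]
  have : 0 ≤ C / l * Real.exp (l * 0) := by positivity
  linarith

/-- The estimate behind the exponentially weighted norm: integrating gains a factor `1 / l`.
Sampling is harmless because `σ u ≤ u` and the weight is increasing. -/
theorem norm_integral_sampled_sub_le {K : NNReal} (hA : LipschitzWith K A) {M : ℝ}
    (hM : ∀ p, ‖A p‖ ≤ M) {δ : ℝ} (hσ : IsSampler δ σ) (hX : Continuous X) (hY : Continuous Y)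
    {l m c : ℝ} (hl : 0 < l) (hm : 0 ≤ m) (hc : 0 ≤ c)
    (hXY : ∀ u ∈ Icc (-Δ) c, ‖X u - Y u‖ ≤ m * Real.exp (l * max u 0)) :
    ‖(∫ u in (0 : ℝ)..c, A (hist Δ X u, hist Δ X (σ u))) -
      ∫ u in (0 : ℝ)..c, A (hist Δ Y u, hist Δ Y (σ u))‖ ≤ K * m / l * Real.exp (l * c) := by
  rw [← intervalIntegral.integral_sub
    (intervalIntegrable_sampled hA.continuous hσ.measurable hX (fun _ => hM _) _ _)
    (intervalIntegrable_sampled hA.continuous hσ.measurable hY (fun _ => hM _) _ _)]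
  have key : ∀ s u : ℝ, 0 ≤ s → s ≤ u → u ≤ c →
      ‖hist Δ X s - hist Δ Y s‖ ≤ m * Real.exp (l * u) := by
    intro s u hs hsu huc
    refine norm_hist_sub_le hX hY (by positivity) fun v hv => ?_
    refine (hXY v ⟨by linarith [hv.1], by linarith [hv.2]⟩).trans ?_
    have : max v 0 ≤ u := max_le (by linarith [hv.2]) (by linarith)
    gcongr
  refine (intervalIntegral.norm_integral_le_of_norm_le hc (g := fun u => K * m * Real.exp (l * u))
    (Eventually.of_forall fun u hu => ?_) (Continuous.intervalIntegrable (by fun_prop) _ _)).trans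
    (integral_exp_mul_le hl _ _ (by positivity))
  refine (hA.dist_le_mul _ _ |> fun h => (dist_eq_norm _ _).symm.trans_le h).trans ?_
  rw [mul_assoc, Prod.dist_eq]
  gcongr
  refine max_le ?_ ?_
  · rw [dist_eq_norm]
    exact key u u hu.1.le le_rfl hu.2
  · rw [dist_eq_norm]
    exact key _ u (hσ.nonneg u) (hσ.le u hu.1.le) hu.2

theorem sampled_volterra_unique {K : NNReal} (hA : LipschitzWith K A) {M : ℝ}
    (hM : ∀ p, ‖A p‖ ≤ M) {δ : ℝ} (hσ : IsSampler δ σ) (hX : Continuous X) (hY : Continuous Y)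
    {c : ℝ} (hc : 0 ≤ c) (h0 : ∀ s ∈ Icc (-Δ) 0, X s = Y s)
    (hXe : ∀ s ∈ Icc 0 c, X s = X 0 + ∫ u in (0 : ℝ)..s, A (hist Δ X u, hist Δ X (σ u)))
    (hYe : ∀ s ∈ Icc 0 c, Y s = X 0 + ∫ u in (0 : ℝ)..s, A (hist Δ Y u, hist Δ Y (σ u))) :
    ∀ s ∈ Icc (-Δ) c, X s = Y s := by
  -- With this weight the maximal weighted distance `m` satisfies `m ≤ K / (K + 1) * m`, so it
  -- vanishes.
  set l : ℝ := K + 1 with hl_def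
  have hl : 0 < l := by positivity
  obtain ⟨s₀, hs₀, hmax⟩ := (isCompact_Icc (a := (0 : ℝ)) (b := c)).exists_isMaxOn
    (nonempty_Icc.2 hc) (f := fun s => Real.exp (-(l * s)) * ‖X s - Y s‖)
    (by fun_prop)
  set m : ℝ := Real.exp (-(l * s₀)) * ‖X s₀ - Y s₀‖ with hm_def
  have hm : 0 ≤ m := by positivity
  have hb : ∀ s ∈ Icc 0 c, ‖X s - Y s‖ ≤ m * Real.exp (l * s) := by
    intro s hs
    have := hmax hs
    simp only [mem_ofPred_eq] at this
    rw [Real.exp_neg, inv_mul_le_iff₀ (Real.exp_pos _)] at this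
    linarith
  have hb' : ∀ u ∈ Icc (-Δ) c, ‖X u - Y u‖ ≤ m * Real.exp (l * max u 0) := by
    intro u hu
    rcases le_total u 0 with h | h
    · rw [h0 u ⟨hu.1, h⟩, sub_self, norm_zero]
      positivity
    · rw [max_eq_left h]
      exact hb u ⟨h, hu.2⟩
  have hm0 : m ≤ 0 := by
    have h1 := norm_integral_sampled_sub_le hA hM hσ hX hY hl hm hs₀.1
      (fun u hu => hb' u ⟨hu.1, hu.2.trans hs₀.2⟩)
    have e : X s₀ - Y s₀ = (∫ u in (0 : ℝ)..s₀, A (hist Δ X u, hist Δ X (σ u))) -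
      ∫ u in (0 : ℝ)..s₀, A (hist Δ Y u, hist Δ Y (σ u)) := by
      rw [hXe s₀ hs₀, hYe s₀ hs₀]
      abel
    rw [← e] at h1
    have h2 : m ≤ K * m / l := by
      rw [hm_def, Real.exp_neg, inv_mul_le_iff₀ (Real.exp_pos _), ← Real.exp_neg, ← hm_def]
      linarith
    rw [le_div_iff₀ hl, hl_def] at h2
    linarith
  intro s hs
  have := hb' s hs
  have h3 : m = 0 := le_antisymm hm0 hm
  rw [h3, zero_mul] at this
  exact sub_eq_zero.1 (norm_le_zero_iff.1 this)

open BoundedContinuousFunction in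
theorem exists_sampled_volterra [CompleteSpace E] {K : NNReal} (hA : LipschitzWith K A) {M : ℝ}
    (hM : ∀ p, ‖A p‖ ≤ M) {δ : ℝ} (hσ : IsSampler δ σ) (φ : C(ℝ, E)) :
    ∃ X : ℝ → E, Continuous X ∧
      ∀ s, X s = φ s + ∫ u in (0 : ℝ)..max s 0, A (hist Δ X u, hist Δ X (σ u)) := by
  have hM0 : 0 ≤ M := (norm_nonneg _).trans (hM 0)
  set l : ℝ := K + 1 with hl_def
  have hl : 0 < l := by positivity
  -- The unknown is the weighted deviation `y` of `X` from `φ`; it is bounded, so the ordinary sup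
  -- norm on `y` is the weighted norm on `X`.
  let S : (ℝ →ᵇ E) → ℝ → E := fun y s => φ s + Real.exp (l * max s 0) • y s
  have hS : ∀ y, Continuous (S y) := fun y => by fun_prop
  let I : (ℝ →ᵇ E) → ℝ → E := fun y s =>
    ∫ u in (0 : ℝ)..s, A (hist Δ (S y) u, hist Δ (S y) (σ u))
  have hI : ∀ y, Continuous (I y) := fun y => intervalIntegral.continuous_primitive
    (intervalIntegrable_sampled hA.continuous hσ.measurable (hS y) fun _ => hM _) 0
  let N : (ℝ →ᵇ E) → ℝ →ᵇ E := fun y => ofNormedAddCommGroup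
    (fun s => Real.exp (-(l * max s 0)) • I y (max s 0))
    (by have := hI y; fun_prop) (M / l) (by
      intro s
      set u := max s 0
      have hu : 0 ≤ u := le_max_right _ _
      have h1 : ‖I y u‖ ≤ M * |u - 0| :=
        intervalIntegral.norm_integral_le_of_norm_le_const fun _ _ => hM _
      rw [sub_zero, abs_of_nonneg hu] at h1
      rw [norm_smul, Real.norm_of_nonneg (Real.exp_pos _).le, Real.exp_neg,
        inv_mul_le_iff₀ (Real.exp_pos _)]
      refine h1.trans ?_
      rw [← mul_div_assoc, le_div_iff₀ hl]
      nlinarith [Real.add_one_le_exp (l * u)])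
  have hN : ContractingWith (K / (K + 1)) N := by
    refine ⟨(div_lt_one (by positivity)).2 (lt_add_one K), LipschitzWith.of_dist_le_mul ?_⟩
    intro y y'
    refine (dist_le (by positivity)).2 fun s => ?_
    set u := max s 0 with hu_def
    have hu : 0 ≤ u := le_max_right _ _
    have h1 := norm_integral_sampled_sub_le hA hM hσ (hS y) (hS y') hl
      (dist_nonneg (x := y) (y := y')) hu (by
        intro v _
        have : S y v - S y' v = Real.exp (l * max v 0) • (y v - y' v) := by
          simp only [S]
          module
        rw [this, norm_smul, Real.norm_of_nonneg (Real.exp_pos _).le, mul_comm]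
        gcongr
        rw [← dist_eq_norm]
        exact dist_coe_le_dist v)
    change dist (Real.exp (-(l * u)) • I y u) (Real.exp (-(l * u)) • I y' u) ≤ _
    rw [dist_eq_norm, ← smul_sub, norm_smul, Real.norm_of_nonneg (Real.exp_pos _).le, Real.exp_neg,
      inv_mul_le_iff₀ (Real.exp_pos _)]
    refine h1.trans (le_of_eq ?_)
    push_cast
    rw [hl_def]
    ring
  have hfix : N (hN.fixedPoint N) = hN.fixedPoint N := hN.fixedPoint_isFixedPt
  set y := hN.fixedPoint N
  refine ⟨S y, hS y, fun s => ?_⟩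
  have h2 : y s = Real.exp (-(l * max s 0)) • I y (max s 0) := by
    conv_lhs => rw [← hfix]
    rfl
  change φ s + Real.exp (l * max s 0) • y s = _
  rw [h2, smul_smul, ← Real.exp_add, add_neg_cancel, Real.exp_zero, one_smul]

/-- A right derivative exists at every time, sampling times included, because `σ` is locally
constant to the right. The Dini comparison needs exactly this. -/
theorem hasDerivWithinAt_sampled [CompleteSpace E] (hA : Continuous A) {M : ℝ}
    (hM : ∀ p, ‖A p‖ ≤ M) {δ : ℝ} (hσ : IsSampler δ σ) (hX : Continuous X)
    (hXe : ∀ s, 0 ≤ s → X s = X 0 + ∫ u in (0 : ℝ)..s, A (hist Δ X u, hist Δ X (σ u)))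
    {t : ℝ} (ht : 0 ≤ t) :
    HasDerivWithinAt X (A (hist Δ X t, hist Δ X (σ t))) (Ici t) t := by
  have h2 := (intervalIntegral.integral_hasDerivWithinAt_right
    (intervalIntegrable_sampled hA hσ.measurable hX (fun _ => hM _) 0 t) (s := Ici t) (t := Ioi t)
    (stronglyMeasurable_sampled hA hσ.measurable hX).stronglyMeasurableAtFilter
    (continuousWithinAt_sampled hA hX
      (nhdsWithin_mono t Ioi_subset_Ici_self (hσ.eventually_eq t ht)))).const_add (X 0)
  exact h2.congr (fun s hs => hXe s (ht.trans hs)) (hXe t ht)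

theorem lipschitzWith_primitive {g : ℝ → E} {M : NNReal} (hg : ∀ u, ‖g u‖ ≤ M)
    (hgi : ∀ b c, IntervalIntegrable g volume b c) :
    LipschitzWith M fun s : ℝ => ∫ u in (0 : ℝ)..s, g u := by
  refine LipschitzWith.of_dist_le_mul fun s s' => ?_
  rw [dist_eq_norm, intervalIntegral.integral_interval_sub_left (hgi _ _) (hgi _ _), Real.dist_eq]
  exact intervalIntegral.norm_integral_le_of_norm_le_const fun _ _ => hg _

theorem lipschitzWith_of_volterra {φ : ℝ → E} {L M : NNReal} (hφ : LipschitzWith L φ)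
    {g : ℝ → E} (hg : ∀ u, ‖g u‖ ≤ M) (hgi : ∀ b c, IntervalIntegrable g volume b c)
    (hX : ∀ s, X s = φ s + ∫ u in (0 : ℝ)..max s 0, g u) : LipschitzWith (L + M) X := by
  have h1 := (lipschitzWith_primitive hg hgi).comp (LipschitzWith.id.max_const 0)
  rw [mul_one] at h1
  rw [funext hX]
  exact hφ.add h1

/-- On a compact interval both solutions stay in one ball, where `A` agrees with its truncation. -/
theorem sampled_volterra_unique_of_lipschitzOnBounded (hA : LipschitzOnBounded A) {δ : ℝ}
    (hσ : IsSampler δ σ) (hX : Continuous X) (hY : Continuous Y)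
    {c : ℝ} (hc : 0 ≤ c) (h0 : ∀ s ∈ Icc (-Δ) 0, X s = Y s)
    (hXe : ∀ s ∈ Icc 0 c, X s = X 0 + ∫ u in (0 : ℝ)..s, A (hist Δ X u, hist Δ X (σ u)))
    (hYe : ∀ s ∈ Icc 0 c, Y s = X 0 + ∫ u in (0 : ℝ)..s, A (hist Δ Y u, hist Δ Y (σ u))) :
    ∀ s ∈ Icc (-Δ) c, X s = Y s := by
  obtain ⟨B, hB⟩ := (isCompact_Icc (a := -Δ) (b := c)).exists_bound_of_continuousOn
    (f := fun s => (X s, Y s)) (by fun_prop)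
  set ρ := max B 1
  have hρ : 0 < ρ := lt_max_of_lt_right one_pos
  obtain ⟨K, hK⟩ := hA (Metric.closedBall 0 ρ) Metric.isBounded_closedBall
  obtain ⟨M, -, hM⟩ := (hA.isBounded_image
    (Metric.isBounded_closedBall (x := (0 : Hist Δ E × Hist Δ E)) (r := ρ))).exists_pos_norm_le
  have hmem : ∀ p : Hist Δ E × Hist Δ E, radialClamp ρ p ∈ Metric.closedBall 0 ρ := fun p => by
    rw [mem_closedBall_zero_iff]
    exact norm_radialClamp_le hρ p
  have hL : LipschitzWith (K * 2) fun p => A (radialClamp ρ p) := by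
    rw [← lipschitzOnWith_univ]
    exact hK.comp (lipschitzWith_radialClamp hρ).lipschitzOnWith fun p _ => hmem p
  have key : ∀ Z : ℝ → E, Continuous Z → (∀ u ∈ Icc (-Δ) c, ‖Z u‖ ≤ ρ) → ∀ s ∈ Icc 0 c,
      ∫ u in (0 : ℝ)..s, A (hist Δ Z u, hist Δ Z (σ u)) =
      ∫ u in (0 : ℝ)..s, A (radialClamp ρ (hist Δ Z u, hist Δ Z (σ u))) := by
    intro Z hZ hb s hs
    have hh : ∀ u ∈ Icc 0 c, ‖hist Δ Z u‖ ≤ ρ := fun u hu =>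
      norm_hist_le hZ hρ.le fun v hv => hb v ⟨by linarith [hu.1, hv.1], hv.2.trans hu.2⟩
    refine intervalIntegral.integral_congr fun u hu => ?_
    rw [uIcc_of_le hs.1] at hu
    have hσu := hσ.le u hu.1
    have huc := hu.2.trans hs.2
    rw [radialClamp_of_norm_le hρ
      (max_le (hh u ⟨hu.1, huc⟩) (hh _ ⟨hσ.nonneg u, hσu.trans huc⟩))]
  have hXb : ∀ u ∈ Icc (-Δ) c, ‖X u‖ ≤ ρ := fun u hu =>
    ((norm_fst_le (X u, Y u)).trans (hB u hu)).trans (le_max_left _ _)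
  have hYb : ∀ u ∈ Icc (-Δ) c, ‖Y u‖ ≤ ρ := fun u hu =>
    ((norm_snd_le (X u, Y u)).trans (hB u hu)).trans (le_max_left _ _)
  refine sampled_volterra_unique hL (fun p => hM _ ⟨_, hmem p, rfl⟩) hσ hX hY hc h0
    (fun s hs => ?_) fun s hs => ?_
  · rw [← key X hX hXb s hs]
    exact hXe s hs
  · rw [← key Y hY hYb s hs]
    exact hYe s hs

end Volterra

/-! ### Decay estimates from Dini derivatives -/

theorem le_add_of_dini_le {w : ℝ → ℝ} {a b k : ℝ} (hab : a ≤ b) (hw : ContinuousOn w (Icc a b))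
    (hD : ∀ t ∈ Ico a b, ∀ r, k < r → ∃ᶠ z in 𝓝[>] t, slope w t z < r) :
    w b ≤ w a + k * (b - a) := by
  refine image_le_of_liminf_slope_right_le_deriv_boundary hw (B := fun t => w a + k * (t - a))
    (B' := fun _ => k) (by simp) (by fun_prop) (fun x _ => ?_) hD (right_mem_Icc.2 hab)
  have := (((hasDerivAt_id x).sub_const a).const_mul k).const_add (w a)
  exact (this.congr_deriv (mul_one k)).hasDerivWithinAt

section Decay

variable {w y α : ℝ → ℝ} {Δ s L ε b c : ℝ}

/-- Scalar form of the practical decay hypotheses: `w` decreases with rate `α (y t) - ε`, and `w` is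
small when `y` has been small on an interval of length `Δ`. -/
structure PracticalDecay (w y α : ℝ → ℝ) (Δ s L ε b c : ℝ) : Prop where
  cont : ContinuousOn w (Icc 0 c)
  nonneg : ∀ t, 0 ≤ y t
  lip : ∀ u v, |y u - y v| ≤ L * |u - v|
  dini : ∀ t ∈ Ico 0 c, ∀ r, -α (y t) + ε < r → ∃ᶠ z in 𝓝[>] t, slope w t z < r
  mono : MonotoneOn α (Ici 0)
  zero : 0 ≤ α 0
  small : ∀ t ∈ Icc 0 c, (∀ u ∈ Icc (t - Δ) t, y u ≤ s) → w t ≤ b / 2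
  Δ_pos : 0 < Δ
  s_pos : 0 < s
  L_pos : 0 < L
  ε_nonneg : 0 ≤ ε
  ε_le : ε * (Δ + s / (2 * L)) ≤ α (s / 2) * (s / (2 * L)) / 2
  ε_le' : ε * (Δ + s / (2 * L)) ≤ b / 4

namespace PracticalDecay

variable (h : PracticalDecay w y α Δ s L ε b c)
include h

theorem growth {t t' : ℝ} (ht : 0 ≤ t) (htt : t ≤ t') (ht' : t' ≤ c) :
    w t' ≤ w t + ε * (t' - t) := by
  refine le_add_of_dini_le htt (h.cont.mono (Icc_subset_Icc ht ht')) fun u hu r hr => ?_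
  refine h.dini u ⟨ht.trans hu.1, hu.2.trans_le ht'⟩ r ?_
  have := h.mono (self_mem_Ici) (h.nonneg u) (h.nonneg u)
  linarith [h.zero]

/-- The window is one delay length `Δ` plus the time `l = s / (2L)` during which `y`, being
`L`-Lipschitz, cannot fall from `s` to below `s / 2`. If `y ≤ s` on `[t, t + Δ]`, then `w ≤ b / 2`
at `t + Δ` and grows by at most `b / 4` afterwards. Otherwise `w` loses `α (s / 2) * l` on a
subinterval, and the total growth due to `ε` returns at most half of it. -/
theorem window {t : ℝ} (ht : 0 ≤ t) (htc : t + (Δ + s / (2 * L)) ≤ c) :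
    w (t + (Δ + s / (2 * L))) ≤ max (w t - α (s / 2) * (s / (2 * L)) / 2) (3 * b / 4) := by
  have hL := h.L_pos
  have hs := h.s_pos
  have hΔ := h.Δ_pos
  have hε := h.ε_nonneg
  have e1 := h.ε_le
  have e2 := h.ε_le'
  have hlL : L * (s / (2 * L)) = s / 2 := by field_simp
  set l := s / (2 * L) with hl
  have hl0 : 0 < l := by positivity
  by_cases hsm : ∀ u ∈ Icc t (t + Δ), y u ≤ s
  · refine le_max_of_le_right ?_
    have h1 := h.small (t + Δ) ⟨by linarith, by linarith⟩ (by simpa using hsm)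
    have h2 := h.growth (t := t + Δ) (t' := t + (Δ + l)) (by linarith) (by linarith) htc
    nlinarith
  · push Not at hsm
    obtain ⟨u, hu, hyu⟩ := hsm
    refine le_max_of_le_left ?_
    have h1 := h.growth ht hu.1 (by linarith [hu.2])
    have h2 := h.growth (t := u + l) (t' := t + (Δ + l)) (by linarith [hu.1]) (by linarith [hu.2])
      htc
    have h3 : w (u + l) ≤ w u + (-α (s / 2) + ε) * (u + l - u) := by
      refine le_add_of_dini_le (by linarith)
        (h.cont.mono (Icc_subset_Icc (by linarith [hu.1]) (by linarith [hu.2])))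
        fun v hv r hr => ?_
      refine h.dini v ⟨by linarith [hu.1, hv.1], by linarith [hu.2, hv.2]⟩ r ?_
      have hyv : s / 2 ≤ y v := by
        have := (abs_le.1 (h.lip v u)).1
        rw [abs_of_nonneg (by linarith [hv.1])] at this
        have : L * (v - u) ≤ L * l := by
          gcongr
          linarith [hv.2]
        linarith
      have := h.mono (by simp; linarith : s / 2 ∈ Ici (0 : ℝ)) (h.nonneg v) hyv
      linarith
    nlinarith

theorem bound_at (k : ℕ) (hk : k * (Δ + s / (2 * L)) ≤ c) :
    w (k * (Δ + s / (2 * L))) ≤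
      max (w 0 - k * (α (s / 2) * (s / (2 * L)) / 2)) (3 * b / 4) := by
  have hM : 0 < Δ + s / (2 * L) := by
    have := h.L_pos; have := h.s_pos; have := h.Δ_pos
    positivity
  have hκ : 0 ≤ α (s / 2) * (s / (2 * L)) / 2 := (mul_nonneg h.ε_nonneg hM.le).trans h.ε_le
  induction k with
  | zero => simp
  | succ k ih =>
    push_cast at hk ⊢
    rw [add_mul, one_mul] at hk ⊢
    have h1 := ih (by linarith)
    refine (h.window (by positivity) hk).trans (max_le ?_ (le_max_right _ _))
    rcases le_max_iff.1 h1 with h2 | h2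
    · refine le_max_of_le_left ?_
      linarith
    · refine le_max_of_le_right ?_
      linarith

/-- Rounding `t` down to a multiple of the window length costs one window of growth, at most `b /
4`. -/
theorem bound {t : ℝ} (ht : t ∈ Icc 0 c) :
    w t ≤ max (w 0 - ⌊t / (Δ + s / (2 * L))⌋₊ * (α (s / 2) * (s / (2 * L)) / 2)) (3 * b / 4) +
      b / 4 := by
  have hM : 0 < Δ + s / (2 * L) := by
    have := h.L_pos; have := h.s_pos; have := h.Δ_pos
    positivity
  have h1 : ⌊t / (Δ + s / (2 * L))⌋₊ * (Δ + s / (2 * L)) ≤ t := by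
    rw [← le_div_iff₀ hM]
    exact Nat.floor_le (div_nonneg ht.1 hM.le)
  have h2 : t < (⌊t / (Δ + s / (2 * L))⌋₊ + 1) * (Δ + s / (2 * L)) := by
    rw [← div_lt_iff₀ hM]
    exact Nat.lt_floor_add_one _
  have h3 := h.bound_at _ (h1.trans ht.2)
  have h4 := h.growth (by positivity) h1 ht.2
  have h5 := h.ε_le'
  have h6 := h.ε_nonneg
  nlinarith

theorem le_of_zero_le {w₀ : ℝ} (hw₀ : w 0 ≤ w₀) (hw₀' : 0 ≤ w₀) {t : ℝ} (ht : t ∈ Icc 0 c) :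
    w t ≤ w₀ + b := by
  have hM : 0 < Δ + s / (2 * L) := by
    have := h.L_pos; have := h.s_pos; have := h.Δ_pos
    positivity
  have hM' := (mul_nonneg h.ε_nonneg hM.le)
  have hκ : 0 ≤ α (s / 2) * (s / (2 * L)) / 2 := hM'.trans h.ε_le
  have hb := hM'.trans h.ε_le'
  have h1 := h.bound ht
  have h2 : 0 ≤ ⌊t / (Δ + s / (2 * L))⌋₊ * (α (s / 2) * (s / (2 * L)) / 2) := by positivity
  rcases le_max_iff.1 (le_refl (max (w 0 - ⌊t / (Δ + s / (2 * L))⌋₊ *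
    (α (s / 2) * (s / (2 * L)) / 2)) (3 * b / 4))) with h3 | h3 <;> linarith

theorem le_of_large {w₀ : ℝ} (hw₀ : w 0 ≤ w₀) (hα : 0 < α (s / 2)) {t : ℝ} (ht : t ∈ Icc 0 c)
    (htT : (w₀ / (α (s / 2) * (s / (2 * L)) / 2) + 1) * (Δ + s / (2 * L)) ≤ t) : w t ≤ b := by
  have hL := h.L_pos; have hs := h.s_pos; have hΔ := h.Δ_pos
  have hM : 0 < Δ + s / (2 * L) := by positivity
  have hκ : 0 < α (s / 2) * (s / (2 * L)) / 2 := by positivity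
  have hb := (mul_nonneg h.ε_nonneg hM.le).trans h.ε_le'
  have h1 := h.bound ht
  -- Enough full windows have passed to exhaust `w₀`, so the decreasing entry of the maximum is
  -- nonpositive.
  have h2 : w₀ ≤ ⌊t / (Δ + s / (2 * L))⌋₊ * (α (s / 2) * (s / (2 * L)) / 2) := by
    rw [← div_le_iff₀ hκ]
    rw [← le_div_iff₀ hM] at htT
    linarith [Nat.lt_floor_add_one (t / (Δ + s / (2 * L)))]
  rcases le_max_iff.1 (le_refl (max (w 0 - ⌊t / (Δ + s / (2 * L))⌋₊ *
    (α (s / 2) * (s / (2 * L)) / 2)) (3 * b / 4))) with h3 | h3 <;> linarith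

end PracticalDecay

end Decay

/-! ### Dini derivatives along solutions -/

section Dini

variable {Δ : ℝ} [Fact (0 < Δ)] {E : Type} [NormedAddCommGroup E] [NormedSpace ℝ E]

/-- The two histories coincide on `[-Δ, -h)`, and on `[-h, 0]` they differ by the remainder of the
right derivative. -/
theorem eventually_dist_hist_driverShift_le {X : ℝ → E} (hX : Continuous X) {t : ℝ} {v : E}
    (hv : HasDerivWithinAt X v (Ici t) t) {η : ℝ} (hη : 0 < η) :
    ∀ᶠ h in 𝓝[>] (0 : ℝ), dist (hist Δ X (t + h)) (driverShift (hist Δ X t) h v) ≤ η * h := by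
  have h1 := (hasDerivWithinAt_iff_isLittleO.1 hv).bound hη
  obtain ⟨e, he, he'⟩ := mem_nhdsGE_iff_exists_Ico_subset.1 h1
  have he0 : 0 < e - t := sub_pos.2 he
  filter_upwards [Ioo_mem_nhdsGT he0] with h hh
  refine (ContinuousMap.dist_le (mul_nonneg hη.le hh.1.le)).2 fun θ => ?_
  rw [hist_apply hX, dist_eq_norm]
  change ‖X (t + h + θ) - (if (θ : ℝ) < -h then _ else _)‖ ≤ _
  split_ifs with hθ
  · have hm : (θ : ℝ) + h ∈ Icc (-Δ) (0 : ℝ) := ⟨by linarith [θ.2.1, hh.1], by linarith⟩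
    rw [ContinuousMap.IccExtendCM_of_mem hm, hist_apply hX]
    have : t + h + θ = t + (θ + h) := by ring
    simp only [this, sub_self, norm_zero]
    exact mul_nonneg hη.le hh.1.le
  · rw [hist_zeroPt hX]
    have h2 := he' (show t + h + θ ∈ Ico t e from
      ⟨by linarith, by linarith [θ.2.2, hh.2]⟩)
    simp only [mem_ofPred_eq] at h2
    have e1 : t + h + θ - t = θ + h := by ring
    rw [e1, Real.norm_of_nonneg (by linarith), sub_sub] at h2
    exact h2.trans (by gcongr; linarith [θ.2.2])

theorem eventually_slope_lt_of_driver {V : Hist Δ E → ℝ} (hV : LocallyLipschitz V) {X : ℝ → E}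
    (hX : Continuous X) {t : ℝ} {v : E} (hv : HasDerivWithinAt X v (Ici t) t) {k : ℝ}
    (hk : ∀ c, k < c → ∀ᶠ h in 𝓝[>] (0 : ℝ),
      (V (driverShift (hist Δ X t) h v) - V (hist Δ X t)) / h < c)
    {r : ℝ} (hr : k < r) :
    ∀ᶠ z in 𝓝[>] t, slope (fun s => V (hist Δ X s)) t z < r := by
  obtain ⟨K, U, hU, hK⟩ := hV (hist Δ X t)
  -- Half of the gap `r - k` pays for replacing the true history by the Driver shift, at Lipschitz
  -- cost `K`; the summand 1 covers `K = 0`.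
  have hη : 0 < (r - k) / 2 / (K + 1) := div_pos (by linarith) (by positivity)
  set η := (r - k) / 2 / (K + 1) with hη_def
  have hd := eventually_dist_hist_driverShift_le (Δ := Δ) hX hv hη
  have hlim1 : Tendsto (fun h => hist Δ X (t + h)) (𝓝[>] 0) (𝓝 (hist Δ X t)) := by
    have : Continuous fun h => hist Δ X (t + h) :=
      (continuous_hist hX).comp (continuous_const.add continuous_id)
    have h2 := this.tendsto 0
    rw [add_zero] at h2
    exact h2.mono_left nhdsWithin_le_nhds
  have hlim2 : Tendsto (fun h => driverShift (hist Δ X t) h v) (𝓝[>] 0) (𝓝 (hist Δ X t)) := by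
    refine (tendsto_iff_of_dist ?_).1 hlim1
    refine squeeze_zero' (Eventually.of_forall fun _ => dist_nonneg) hd ?_
    have : Continuous fun h : ℝ => η * h := by fun_prop
    have h2 := this.tendsto 0
    rw [mul_zero] at h2
    exact h2.mono_left nhdsWithin_le_nhds
  have hmain : ∀ᶠ h in 𝓝[>] (0 : ℝ), (V (hist Δ X (t + h)) - V (hist Δ X t)) / h < r := by
    filter_upwards [hd, hlim1 hU, hlim2 hU, hk ((k + r) / 2) (by linarith), self_mem_nhdsWithin]
      with h h1 h2 h3 h4 h5
    rw [div_lt_iff₀ h5] at h4 ⊢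
    have h6 := (le_abs_self _).trans ((Real.dist_eq _ _).symm.trans_le (hK.dist_le_mul _ h2 _ h3))
    have h7 : (K : ℝ) * dist (hist Δ X (t + h)) (driverShift (hist Δ X t) h v) ≤
        (r - k) / 2 * h := by
      calc _ ≤ ((K : ℝ) + 1) * (η * h) := by gcongr; linarith
        _ = _ := by rw [hη_def]; field_simp
    linarith
  have hmap : Tendsto (fun z => z - t) (𝓝[>] t) (𝓝[>] 0) := by
    refine tendsto_nhdsWithin_iff.2 ⟨?_, ?_⟩
    · have : Continuous fun z : ℝ => z - t := by fun_prop
      have h2 := this.tendsto t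
      rw [sub_self] at h2
      exact h2.mono_left nhdsWithin_le_nhds
    · filter_upwards [self_mem_nhdsWithin] with z hz
      exact mem_Ioi.2 (sub_pos.2 (mem_Ioi.1 hz))
  filter_upwards [hmap.eventually hmain] with z hz
  rw [slope_def_field]
  simpa using hz

end Dini

/-! ### Practical stability of sampled systems -/

section Stability

variable {Δ : ℝ} [Fact (0 < Δ)] {E : Type} [NormedAddCommGroup E]

theorem IccExtendCM_of_nonneg (φ : Hist Δ E) {s : ℝ} (hs : 0 ≤ s) :
    ContinuousMap.IccExtendCM φ s = φ (zeroPt Δ) :=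
  IccExtend_of_right_le (factLe Δ).out _ hs

theorem lipschitzWith_IccExtendCM {φ : Hist Δ E} {L : NNReal} (hφ : LipschitzWith L φ) :
    LipschitzWith L (ContinuousMap.IccExtendCM φ) := by
  have := hφ.comp (LipschitzWith.projIcc (factLe Δ).out)
  rwa [mul_one] at this

variable [NormedSpace ℝ E]

/-- Practical stability: under a Lyapunov–Krasovskii functional for the continuous-time loop
`A (φ, φ)`, solutions of the sampled loop exist, stay bounded and enter the ball of radius `r`. -/
theorem exists_sampled_practical_stability [CompleteSpace E] {A : Hist Δ E × Hist Δ E → E}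
    (hA : LipschitzOnBounded A) {V : Hist Δ E → ℝ} (hV : LocallyLipschitz V)
    {G : Hist Δ E × Hist Δ E → ℝ} (hG : LipschitzOnBounded G) {α : ℝ → ℝ} (hα : IsClassK α)
    (hGα : ∀ φ, G (φ, φ) ≤ -α ‖φ (zeroPt Δ)‖)
    (hdrv : ∀ φ ψ c, G (φ, ψ) < c → ∀ᶠ h in 𝓝[>] (0 : ℝ),
      (V (driverShift φ h (A (φ, ψ))) - V φ) / h < c)
    {γ₁ γ₂ : ℝ → ℝ} (hγ₁ : IsClassKInfty γ₁) (hγ₂ : IsClassKInfty γ₂)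
    (hγ : ∀ φ, γ₁ ‖φ (zeroPt Δ)‖ ≤ V φ ∧ V φ ≤ γ₂ ‖φ‖) (L₀ : NNReal) {R r : ℝ} (hR : 0 < R)
    (hr : 0 < r) :
    ∃ δ T ρ : ℝ, 0 < δ ∧ 0 < T ∧ 0 < ρ ∧ ∀ σ, IsSampler δ σ → ∀ φ : Hist Δ E,
      LipschitzWith L₀ φ → ‖φ‖ ≤ R → ∃ (X : ℝ → E) (L : NNReal), LipschitzWith L X ∧
        (∀ θ : Icc (-Δ) (0 : ℝ), X θ = φ θ) ∧
        (∀ s, 0 ≤ s → X s = X 0 + ∫ u in (0 : ℝ)..s, A (hist Δ X u, hist Δ X (σ u))) ∧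
        (∀ s, ‖X s‖ ≤ ρ) ∧ (∀ s, T ≤ s → ‖X s‖ ≤ r) := by
  have hΔ : 0 < Δ := Fact.out
  obtain ⟨⟨hγ₁c, hγ₁0, hγ₁m⟩, hγ₁u⟩ := hγ₁
  obtain ⟨⟨hγ₂c, hγ₂0, hγ₂m⟩, -⟩ := hγ₂
  obtain ⟨-, hα0, hαm⟩ := hα
  -- Target level: `V ≤ γ₁ r` forces `‖X t‖ ≤ r`.
  have hb : 0 < γ₁ r := by
    rw [← hγ₁0]
    exact hγ₁m self_mem_Ici hr.le hr
  set b := γ₁ r with hb_def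
  obtain ⟨s, hs, hsb⟩ : ∃ s, 0 < s ∧ γ₂ s ≤ b / 2 := by
    have h1 : ∀ᶠ s in 𝓝[>] (0 : ℝ), γ₂ s < b / 2 := by
      have h2 := (hγ₂c 0 self_mem_Ici).mono Ioi_subset_Ici_self
      refine h2.eventually_lt_const ?_
      rw [hγ₂0]
      linarith
    obtain ⟨s, h2, h3⟩ := (h1.and self_mem_nhdsWithin).exists
    exact ⟨s, h3, h2.le⟩
  have hW₀ : 0 ≤ γ₂ R := by
    rw [← hγ₂0]
    exact hγ₂m.monotoneOn self_mem_Ici hR.le hR.le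
  -- The decay estimate keeps `V` below `γ₂ R + b`, hence below `γ₁ ρ`, so the sphere of radius `ρ`
  -- is out of reach.
  obtain ⟨ρ, hRρ, hρb⟩ : ∃ ρ, R < ρ ∧ γ₂ R + b < γ₁ ρ := by
    obtain ⟨_, ⟨e, he, rfl⟩, he'⟩ := not_bddAbove_iff.1 hγ₁u (γ₂ R + b)
    have h1 : e ≤ max e (R + 1) := le_max_left _ _
    refine ⟨max e (R + 1), lt_max_of_lt_right (lt_add_one R), he'.trans_le ?_⟩
    exact hγ₁m.monotoneOn he (le_trans he h1) h1
  have hρ : 0 < ρ := hR.trans hRρ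
  obtain ⟨KA, hKA⟩ := hA (Metric.closedBall 0 ρ) Metric.isBounded_closedBall
  obtain ⟨M, hM0, hM⟩ := (hA.isBounded_image
    (Metric.isBounded_closedBall (x := (0 : Hist Δ E × Hist Δ E)) (r := ρ))).exists_pos_norm_le
  lift M to NNReal using hM0.le
  obtain ⟨KG, hKG⟩ := hG (Metric.closedBall 0 ρ) Metric.isBounded_closedBall
  -- Slope of the initial history plus the bound of the field on the ball. It is independent of the
  -- sampling, so `δ` may be chosen after it.
  set L : NNReal := L₀ + M with hL_def
  have hL : 0 < (L : ℝ) := by rw [hL_def]; push_cast; positivity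
  set l := s / (2 * (L : ℝ)) with hl_def
  have hl : 0 < l := by positivity
  have hαs : 0 < α (s / 2) := by
    rw [← hα0]
    exact hαm self_mem_Ici (by simp; linarith : s / 2 ∈ Ici (0 : ℝ)) (by linarith)
  set κ := α (s / 2) * l / 2 with hκ_def
  have hκ : 0 < κ := by positivity
  have hε : 0 < min κ (b / 4) / (Δ + l) := div_pos (lt_min hκ (by positivity)) (by positivity)
  set ε := min κ (b / 4) / (Δ + l) with hε_def
  have hεm : ε * (Δ + l) = min κ (b / 4) := by
    rw [hε_def]
    field_simp
  -- This `δ` gives `KG * L * δ ≤ ε`: a delay of at most `δ` moves the history by `L * δ` and `G` by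
  -- at most `ε`.
  refine ⟨ε / (KG * L + 1), (γ₂ R / κ + 1) * (Δ + l), ρ, by positivity, by positivity, hρ,
    fun σ hσ φ hφL hφR => ?_⟩
  -- the truncated right-hand side
  let Ac : Hist Δ E × Hist Δ E → E := fun p => A (radialClamp ρ p)
  have hmem : ∀ p : Hist Δ E × Hist Δ E, radialClamp ρ p ∈ Metric.closedBall 0 ρ := fun p => by
    rw [mem_closedBall_zero_iff]
    exact norm_radialClamp_le hρ p
  have hAcL : LipschitzWith (KA * 2) Ac := by
    rw [← lipschitzOnWith_univ]
    exact hKA.comp (lipschitzWith_radialClamp hρ).lipschitzOnWith fun p _ => hmem p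
  have hAcM : ∀ p, ‖Ac p‖ ≤ M := fun p => hM _ ⟨_, hmem p, rfl⟩
  have hAceq : ∀ p₁ p₂ : Hist Δ E, ‖p₁‖ ≤ ρ → ‖p₂‖ ≤ ρ → Ac (p₁, p₂) = A (p₁, p₂) :=
    fun p₁ p₂ h1 h2 => congrArg A (radialClamp_of_norm_le hρ (max_le h1 h2))
  -- The history is extended by the constant `φ(0)` to the right of 0, so for nonnegative times the
  -- equation reads `X 0` plus the integral.
  obtain ⟨X, hXc, hXe⟩ := exists_sampled_volterra hAcL hAcM hσ (ContinuousMap.IccExtendCM φ)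
  have hXL : LipschitzWith L X := lipschitzWith_of_volterra (lipschitzWith_IccExtendCM hφL)
    (fun _ => hAcM _)
    (intervalIntegrable_sampled hAcL.continuous hσ.measurable hXc fun _ => hAcM _) hXe
  have hXφ : ∀ u ≤ 0, X u = ContinuousMap.IccExtendCM φ u := fun u hu => by
    rw [hXe, max_eq_right hu, intervalIntegral.integral_same, add_zero]
  have hXint : ∀ u, 0 ≤ u →
      X u = X 0 + ∫ v in (0 : ℝ)..u, Ac (hist Δ X v, hist Δ X (σ v)) := fun u hu => by
    rw [hXφ 0 le_rfl, hXe u, max_eq_left hu, IccExtendCM_of_nonneg φ hu,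
      IccExtendCM_of_nonneg φ le_rfl]
  have hXneg : ∀ u ≤ 0, ‖X u‖ < ρ := fun u hu => by
    rw [hXφ u hu]
    exact ((norm_IccExtendCM_le φ u).trans hφR).trans_lt hRρ
  have hX0 : ‖hist Δ X 0‖ ≤ R := norm_hist_le hXc hR.le fun u hu => by
    rw [hXφ u hu.2]
    exact (norm_IccExtendCM_le φ u).trans hφR
  -- decay as long as the solution stays in the ball of radius `ρ`
  have hdecay : ∀ c, (∀ u < c, ‖X u‖ ≤ ρ) →
      PracticalDecay (fun t => V (hist Δ X t)) (fun t => ‖X t‖) α Δ s L ε b c := by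
    intro c hc
    have hhist : ∀ u < c, ‖hist Δ X u‖ ≤ ρ := fun u hu =>
      norm_hist_le hXc hρ.le fun v hv => hc v (hv.2.trans_lt hu)
    refine ⟨(hV.continuous.comp (continuous_hist hXc)).continuousOn, fun _ => norm_nonneg _,
      fun u v => ?_, fun t ht k hk => ?_, hαm.monotoneOn, hα0.ge, fun t ht hsm => ?_, hΔ, hs, hL,
      hε.le, hεm.trans_le (min_le_left _ _), hεm.trans_le (min_le_right _ _)⟩
    · exact (abs_norm_sub_norm_le _ _).trans
        ((dist_eq_norm _ _).symm.trans_le (hXL.dist_le_mul u v))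
    · have hσt : σ t ≤ t := hσ.le t ht.1
      have h1 := hasDerivWithinAt_sampled hAcL.continuous hAcM hσ hXc hXint ht.1
      have hp : ‖hist Δ X t‖ ≤ ρ := hhist t ht.2
      have hq : ‖hist Δ X (σ t)‖ ≤ ρ := hhist _ (hσt.trans_lt ht.2)
      rw [hAceq _ _ hp hq] at h1
      have h2 : G (hist Δ X t, hist Δ X (σ t)) ≤ -α ‖X t‖ + ε := by
        have h3 := (le_abs_self _).trans ((Real.dist_eq _ _).symm.trans_le
          (hKG.dist_le_mul (hist Δ X t, hist Δ X (σ t))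
            (mem_closedBall_zero_iff.2 (max_le hp hq)) (hist Δ X t, hist Δ X t)
            (mem_closedBall_zero_iff.2 (max_le hp hp))))
        have h4 : dist (hist Δ X t, hist Δ X (σ t)) (hist Δ X t, hist Δ X t) ≤
            L * (ε / (KG * L + 1)) := by
          rw [Prod.dist_eq]
          refine max_le (by simp only [dist_self]; positivity) ?_
          refine (dist_hist_le hXL _ _).trans ?_
          gcongr
          rw [abs_of_nonpos (by linarith)]
          linarith [hσ.ge t ht.1]
        have h5 : (KG : ℝ) * (L * (ε / (KG * L + 1))) ≤ ε := by
          rw [← mul_assoc, ← mul_div_assoc, div_le_iff₀ (by positivity)]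
          nlinarith
        have h6 := hGα (hist Δ X t)
        rw [hist_zeroPt hXc] at h6
        have h7 := mul_le_mul_of_nonneg_left h4 KG.coe_nonneg
        linarith
      exact (eventually_slope_lt_of_driver hV hXc h1 (hdrv _ _) (h2.trans_lt hk)).frequently
    · have h1 : ‖hist Δ X t‖ ≤ s := norm_hist_le hXc hs.le hsm
      exact ((hγ _).2.trans (hγ₂m.monotoneOn (norm_nonneg _) hs.le h1)).trans hsb
  have hw0 : V (hist Δ X 0) ≤ γ₂ R :=
    (hγ _).2.trans (hγ₂m.monotoneOn (norm_nonneg _) hR.le hX0)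
  have hVX : ∀ t, γ₁ ‖X t‖ ≤ V (hist Δ X t) := fun t => by
    have := (hγ (hist Δ X t)).1
    rwa [hist_zeroPt hXc] at this
  have hin : ∀ t, ‖X t‖ < ρ := by
    intro t
    by_contra! hbad
    have ht0 : 0 ≤ t := by
      by_contra! h
      exact absurd (hXneg t h.le) (not_lt.2 hbad)
    have hcl : IsClosed {t | 0 ≤ t ∧ ρ ≤ ‖X t‖} :=
      (isClosed_le continuous_const continuous_id).inter
        (isClosed_le continuous_const hXc.norm)
    have hbd : BddBelow {t | 0 ≤ t ∧ ρ ≤ ‖X t‖} := ⟨0, fun _ h => h.1⟩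
    have hmin := hcl.csInf_mem ⟨t, ht0, hbad⟩ hbd
    -- First exit time. The decay estimate on `[0, τ]` needs the bound `ρ` only before `τ`, and it
    -- contradicts `ρ ≤ ‖X τ‖`.
    set τ := sInf {t | 0 ≤ t ∧ ρ ≤ ‖X t‖} with hτ
    have hlt : ∀ u < τ, ‖X u‖ ≤ ρ := fun u hu => by
      rcases le_total u 0 with h | h
      · exact (hXneg u h).le
      · by_contra! h'
        exact absurd (csInf_le hbd ⟨h, h'.le⟩) (not_le.2 hu)
    have h1 := (hdecay τ hlt).le_of_zero_le hw0 hW₀ (right_mem_Icc.2 hmin.1)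
    have h2 : γ₁ ‖X τ‖ < γ₁ ρ := ((hVX τ).trans h1).trans_lt hρb
    exact absurd ((hγ₁m.lt_iff_lt (norm_nonneg _) hρ.le).1 h2) (not_lt.2 hmin.2)
  have hin' : ∀ t, ‖hist Δ X t‖ ≤ ρ := fun t => norm_hist_le hXc hρ.le fun u _ => (hin u).le
  refine ⟨X, L, hXL, fun θ => ?_, fun u hu => ?_, fun u => (hin u).le, fun t ht => ?_⟩
  · rw [hXφ θ θ.2.2, IccExtendCM_coe]
  · rw [hXint u hu]
    simp only [hAceq _ _ (hin' _) (hin' _)]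
  · have ht0 : 0 ≤ t := le_trans (by positivity) ht
    have h1 := (hdecay t fun u _ => (hin u).le).le_of_large hw0 hαs (right_mem_Icc.2 ht0) ht
    exact (hγ₁m.le_iff_le (norm_nonneg _) hr.le).1 ((hVX t).trans h1)

end Stability

/-! ### Blocks -/

section Blocks

variable {Δ : ℝ} {n m q : ℕ}

theorem topBlock_stack (v w : Eu n) : topBlock (stack v w) = v := rfl

theorem botBlock_stack (v w : Eu n) : botBlock (stack v w) = w := rfl

theorem stack_blocks (v : Eu2 n) : stack (topBlock v) (botBlock v) = v := by
  ext i
  rcases i with i | i <;> rfl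

/-- `topBlock` as a continuous linear map. -/
noncomputable def topCLM (n : ℕ) : Eu2 n →L[ℝ] Eu n :=
  LinearMap.toContinuousLinearMap
    { toFun := topBlock, map_add' := fun _ _ => rfl, map_smul' := fun _ _ => rfl }

/-- `botBlock` as a continuous linear map. -/
noncomputable def botCLM (n : ℕ) : Eu2 n →L[ℝ] Eu n :=
  LinearMap.toContinuousLinearMap
    { toFun := botBlock, map_add' := fun _ _ => rfl, map_smul' := fun _ _ => rfl }

theorem topCLM_apply (v : Eu2 n) : topCLM n v = topBlock v := rfl

theorem botCLM_apply (v : Eu2 n) : botCLM n v = botBlock v := rfl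

theorem norm_sq_eq_blocks (v : Eu2 n) : ‖v‖ ^ 2 = ‖topBlock v‖ ^ 2 + ‖botBlock v‖ ^ 2 := by
  rw [EuclideanSpace.norm_sq_eq, EuclideanSpace.norm_sq_eq, EuclideanSpace.norm_sq_eq,
    Fintype.sum_sum_type]
  rfl

theorem norm_topBlock_le (v : Eu2 n) : ‖topBlock v‖ ≤ ‖v‖ := by
  refine le_of_sq_le_sq ?_ (norm_nonneg _)
  rw [norm_sq_eq_blocks]
  linarith [sq_nonneg ‖botBlock v‖]

theorem norm_botBlock_le (v : Eu2 n) : ‖botBlock v‖ ≤ ‖v‖ := by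
  refine le_of_sq_le_sq ?_ (norm_nonneg _)
  rw [norm_sq_eq_blocks]
  linarith [sq_nonneg ‖topBlock v‖]

theorem norm_stack_le (v w : Eu n) : ‖stack v w‖ ≤ ‖v‖ + ‖w‖ := by
  refine le_of_sq_le_sq ?_ (by positivity)
  rw [norm_sq_eq_blocks, topBlock_stack, botBlock_stack]
  nlinarith [mul_nonneg (norm_nonneg v) (norm_nonneg w)]

theorem lipschitzWith_stack : LipschitzWith 2 fun p : Eu n × Eu n => stack p.1 p.2 := by
  refine LipschitzWith.of_dist_le_mul fun p p' => ?_
  have : stack p.1 p.2 - stack p'.1 p'.2 = stack (p.1 - p'.1) (p.2 - p'.2) := by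
    ext i
    rcases i with i | i <;> rfl
  rw [dist_eq_norm, this]
  refine (norm_stack_le _ _).trans ?_
  rw [Prod.dist_eq, dist_eq_norm, dist_eq_norm]
  push_cast
  linarith [le_max_left ‖p.1 - p'.1‖ ‖p.2 - p'.2‖, le_max_right ‖p.1 - p'.1‖ ‖p.2 - p'.2‖]

theorem lipschitzWith_fstHist : LipschitzWith 1 (fstHist : Hist Δ (Eu2 n) → Hist Δ (Eu n)) := by
  refine LipschitzWith.mk_one fun φ ψ => (ContinuousMap.dist_le dist_nonneg).2 fun θ => ?_
  refine le_trans ?_ (ContinuousMap.dist_apply_le_dist (f := φ) (g := ψ) θ)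
  rw [dist_eq_norm, dist_eq_norm]
  exact norm_topBlock_le (φ θ - ψ θ)

theorem lipschitzWith_sndHist : LipschitzWith 1 (sndHist : Hist Δ (Eu2 n) → Hist Δ (Eu n)) := by
  refine LipschitzWith.mk_one fun φ ψ => (ContinuousMap.dist_le dist_nonneg).2 fun θ => ?_
  refine le_trans ?_ (ContinuousMap.dist_apply_le_dist (f := φ) (g := ψ) θ)
  rw [dist_eq_norm, dist_eq_norm]
  exact norm_botBlock_le (φ θ - ψ θ)

theorem norm_pairHist_le (φ ψ : Hist Δ (Eu n)) : ‖pairHist φ ψ‖ ≤ ‖φ‖ + ‖ψ‖ := by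
  refine (ContinuousMap.norm_le _ (by positivity)).2 fun θ => ?_
  exact (norm_stack_le _ _).trans (add_le_add (φ.norm_coe_le_norm θ) (ψ.norm_coe_le_norm θ))

theorem fstHist_hist {X : ℝ → Eu2 n} (hX : Continuous X) (s : ℝ) :
    fstHist (hist Δ X s) = hist Δ (fun u => topBlock (X u)) s := by
  refine ContinuousMap.ext fun θ => ?_
  rw [hist_apply (x := fun u => topBlock (X u)) ((topCLM n).continuous.comp hX)]
  change topBlock (hist Δ X s θ) = _
  rw [hist_apply hX]

theorem sndHist_hist {X : ℝ → Eu2 n} (hX : Continuous X) (s : ℝ) :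
    sndHist (hist Δ X s) = hist Δ (fun u => botBlock (X u)) s := by
  refine ContinuousMap.ext fun θ => ?_
  rw [hist_apply (x := fun u => botBlock (X u)) ((botCLM n).continuous.comp hX)]
  change botBlock (hist Δ X s θ) = _
  rw [hist_apply hX]

/-- The input `(u, velocity of the observer)` computed by the controller from the state `ψ`. -/
def controllerInput (hout : Hist Δ (Eu n) → Eu q)
    (fhat : Hist Δ (Eu n) × Eu m × Eu q → Eu n) (k : Hist Δ (Eu n) × Eu q → Eu m)
    (ψ : Hist Δ (Eu2 n)) : Eu m × Eu n :=
  (k (sndHist ψ, hout (fstHist ψ)),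
    fhat (sndHist ψ, k (sndHist ψ, hout (fstHist ψ)), hout (fstHist ψ)))

/-- The right-hand side of the sampled-data loop with current state `p.1` and sampled state
`p.2`. -/
def sampledField (f : Hist Δ (Eu n) × Eu m → Eu n) (hout : Hist Δ (Eu n) → Eu q)
    (fhat : Hist Δ (Eu n) × Eu m × Eu q → Eu n) (k : Hist Δ (Eu n) × Eu q → Eu m)
    (p : Hist Δ (Eu2 n) × Hist Δ (Eu2 n)) : Eu2 n :=
  openLoop f p.1 (controllerInput hout fhat k p.2)

theorem lipschitzOnBounded_controllerInput {hout : Hist Δ (Eu n) → Eu q}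
    {fhat : Hist Δ (Eu n) × Eu m × Eu q → Eu n} {k : Hist Δ (Eu n) × Eu q → Eu m}
    (hh : LipschitzOnBounded hout) (hfhat : LipschitzOnBounded fhat) (hk : LipschitzOnBounded k) :
    LipschitzOnBounded (controllerInput hout fhat k) := by
  have h1 : LipschitzOnBounded (sndHist : Hist Δ (Eu2 n) → Hist Δ (Eu n)) :=
    .of_lipschitzWith lipschitzWith_sndHist
  have h2 : LipschitzOnBounded fun ψ : Hist Δ (Eu2 n) => hout (fstHist ψ) :=
    hh.comp (.of_lipschitzWith lipschitzWith_fstHist)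
  have h3 : LipschitzOnBounded fun ψ : Hist Δ (Eu2 n) => k (sndHist ψ, hout (fstHist ψ)) :=
    hk.comp (h1.prodMk h2)
  exact h3.prodMk (hfhat.comp (h1.prodMk (h3.prodMk h2)))

theorem lipschitzOnBounded_sampledField {f : Hist Δ (Eu n) × Eu m → Eu n}
    {hout : Hist Δ (Eu n) → Eu q} {fhat : Hist Δ (Eu n) × Eu m × Eu q → Eu n}
    {k : Hist Δ (Eu n) × Eu q → Eu m} (hf : LipschitzOnBounded f) (hh : LipschitzOnBounded hout)
    (hfhat : LipschitzOnBounded fhat) (hk : LipschitzOnBounded k) :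
    LipschitzOnBounded (sampledField f hout fhat k) := by
  have hu : LipschitzOnBounded fun p : Hist Δ (Eu2 n) × Hist Δ (Eu2 n) =>
      controllerInput hout fhat k p.2 :=
    (lipschitzOnBounded_controllerInput hh hfhat hk).comp .snd
  have h1 : LipschitzOnBounded fun p : Hist Δ (Eu2 n) × Hist Δ (Eu2 n) => fstHist p.1 :=
    (LipschitzOnBounded.of_lipschitzWith lipschitzWith_fstHist).comp .fst
  have h2 : LipschitzOnBounded fun p : Eu n × Eu n => stack p.1 p.2 :=
    .of_lipschitzWith lipschitzWith_stack
  have h3 : LipschitzOnBounded fun p : Hist Δ (Eu2 n) × Hist Δ (Eu2 n) =>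
      (controllerInput hout fhat k p.2).1 :=
    LipschitzOnBounded.comp (g := fun u : Eu m × Eu n => u.1) .fst hu
  have h4 : LipschitzOnBounded fun p : Hist Δ (Eu2 n) × Hist Δ (Eu2 n) =>
      (controllerInput hout fhat k p.2).2 :=
    LipschitzOnBounded.comp (g := fun u : Eu m × Eu n => u.2) .snd hu
  have h5 : LipschitzOnBounded fun p : Hist Δ (Eu2 n) × Hist Δ (Eu2 n) =>
      f (fstHist p.1, (controllerInput hout fhat k p.2).1) := hf.comp (h1.prodMk h3)
  have h6 := h2.comp (h5.prodMk h4)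
  exact h6

end Blocks

/-! ### The Lyapunov functional of the closed loop -/

section Lyapunov

variable {Δ : ℝ} [Fact (0 < Δ)] {E : Type} [NormedAddCommGroup E] [NormedSpace ℝ E]

theorem driverShift_zeroPt (φ : Hist Δ E) {h : ℝ} (hh : 0 < h) (v : E) :
    driverShift φ h v (zeroPt Δ) = φ (zeroPt Δ) + h • v := by
  change (if (0 : ℝ) < -h then _ else φ (zeroPt Δ) + ((0 : ℝ) + h) • v) = _
  rw [if_neg (by linarith), zero_add]

theorem eventually_lt_of_driverDeriv_le {V : Hist Δ E → ℝ} {φ : Hist Δ E} {v : E} {g c : ℝ}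
    (hg : driverDeriv V φ v ≤ (g : EReal)) (hc : g < c) :
    ∀ᶠ h in 𝓝[>] (0 : ℝ), (V (driverShift φ h v) - V φ) / h < c := by
  have h1 : driverDeriv V φ v < (c : EReal) := hg.trans_lt (EReal.coe_lt_coe_iff.2 hc)
  filter_upwards [eventually_lt_of_limsup_lt h1] with h hh
  exact EReal.coe_lt_coe_iff.1 hh

theorem driverDeriv_le_of_eventually {V : Hist Δ E → ℝ} {φ : Hist Δ E} {v : E} {c : ℝ}
    (h : ∀ᶠ h in 𝓝[>] (0 : ℝ), (V (driverShift φ h v) - V φ) / h < c) :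
    driverDeriv V φ v ≤ (c : EReal) := by
  refine limsup_le_of_le (by isBoundedDefault) ?_
  filter_upwards [h] with h hh
  exact EReal.coe_le_coe_iff.2 hh.le

theorem tendsto_driver_of_differentiable {W : E → ℝ} (hW : Differentiable ℝ W) (φ : Hist Δ E)
    (v : E) : Tendsto (fun h : ℝ => (W (driverShift φ h v (zeroPt Δ)) - W (φ (zeroPt Δ))) / h)
      (𝓝[>] 0) (𝓝 (fderiv ℝ W (φ (zeroPt Δ)) v)) := by
  have h1 := ((hW (φ (zeroPt Δ))).hasFDerivAt.hasLineDerivAt v).tendsto_slope_zero_right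
  refine h1.congr' ?_
  filter_upwards [self_mem_nhdsWithin] with h hh
  rw [driverShift_zeroPt φ hh]
  simp [div_eq_inv_mul]

variable {n m q : ℕ} {f : Hist Δ (Eu n) × Eu m → Eu n}
    {hout : Hist Δ (Eu n) → Eu q} {fhat : Hist Δ (Eu n) × Eu m × Eu q → Eu n}
    {k : Hist Δ (Eu n) × Eu q → Eu m}

/-- `V₁` is differentiable, so its Driver quotients converge and the limsup for `V` splits into the
derivative of `V₁` along the velocity plus the Driver derivative of `V₂`, which is `g`. Their sum is
`G`; unlike the upper bound given for the closed loop alone, it makes sense for a sampled input and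
varies in a Lipschitz way with it. -/
theorem LyapunovAssumption.exists_functional (hV : LyapunovAssumption f hout fhat k)
    (hf : LipschitzOnBounded f) (hh : LipschitzOnBounded hout)
    (hfhat : LipschitzOnBounded fhat) (hk : LipschitzOnBounded k) :
    ∃ (V : Hist Δ (Eu2 n) → ℝ) (G : Hist Δ (Eu2 n) × Hist Δ (Eu2 n) → ℝ) (α γ₁ γ₂ : ℝ → ℝ),
      LocallyLipschitz V ∧ LipschitzOnBounded G ∧ IsClassK α ∧
      (∀ φ, G (φ, φ) ≤ -α ‖φ (zeroPt Δ)‖) ∧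
      (∀ φ ψ c, G (φ, ψ) < c → ∀ᶠ h in 𝓝[>] (0 : ℝ),
        (V (driverShift φ h (sampledField f hout fhat k (φ, ψ))) - V φ) / h < c) ∧
      IsClassKInfty γ₁ ∧ IsClassKInfty γ₂ ∧
      (∀ φ, γ₁ ‖φ (zeroPt Δ)‖ ≤ V φ ∧ V φ ≤ γ₂ ‖φ‖) := by
  obtain ⟨V, V₁, V₂, β₁, β₂, γ₁, γ₂, p, α₃, η, μ, ν, hsep, hγ₁, hγ₂, -, -, -, -, -, hα, hγ, hD, -,
    g, hg, hgL⟩ := hV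
  have hVe : V = fun φ => V₁ (φ (zeroPt Δ)) + V₂ φ := funext hsep.split
  have heval : LipschitzWith 1 fun φ : Hist Δ (Eu2 n) => φ (zeroPt Δ) :=
    LipschitzWith.mk_one fun φ ψ => ContinuousMap.dist_apply_le_dist _
  have hdiff : Differentiable ℝ V₁ := hsep.V₁_contDiff.differentiable one_ne_zero
  have hfield := lipschitzOnBounded_sampledField hf hh hfhat hk
  have hinp := lipschitzOnBounded_controllerInput hh hfhat hk
  have hDV : LipschitzOnBounded fun p : Hist Δ (Eu2 n) × Hist Δ (Eu2 n) =>
      fderiv ℝ V₁ (p.1 (zeroPt Δ)) :=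
    (LipschitzOnBounded.of_locallyLipschitz hsep.V₁_lipschitz).comp
      ((LipschitzOnBounded.of_lipschitzWith heval).comp .fst)
  have hquot : ∀ φ v h, (V (driverShift φ h v) - V φ) / h =
      (V₁ (driverShift φ h v (zeroPt Δ)) - V₁ (φ (zeroPt Δ))) / h +
        (V₂ (driverShift φ h v) - V₂ φ) / h := by
    intro φ v h
    rw [hVe]
    ring
  refine ⟨V, fun p => fderiv ℝ V₁ (p.1 (zeroPt Δ)) (sampledField f hout fhat k p) +
    g (p.1, controllerInput hout fhat k p.2), α₃, γ₁, γ₂, ?_,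
    (hDV.clm_apply hfield).add (hgL.comp (LipschitzOnBounded.fst.prodMk (hinp.comp .snd))), hα,
    fun φ => ?_, fun φ ψ c hc => ?_, hγ₁, hγ₂, hγ⟩
  · rw [hVe]
    exact (hsep.V₁_contDiff.locallyLipschitz.comp heval.locallyLipschitz).add hsep.V₂_lipschitz
  · refine le_of_forall_pos_le_add fun e he => ?_
    have h1 := eventually_lt_of_driverDeriv_le (hD φ)
      (show _ < -α₃ ‖φ (zeroPt Δ)‖ + e / 2 by linarith)
    have h2 := (tendsto_driver_of_differentiable hdiff φ
      (closedLoop f hout fhat k φ)).eventually_const_lt (sub_lt_self _ (half_pos he))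
    have h3 : driverDeriv V₂ φ (closedLoop f hout fhat k φ) ≤
        ((-α₃ ‖φ (zeroPt Δ)‖ + e -
          fderiv ℝ V₁ (φ (zeroPt Δ)) (closedLoop f hout fhat k φ) : ℝ) : EReal) := by
      refine driverDeriv_le_of_eventually ?_
      filter_upwards [h1, h2] with h h1 h2
      rw [hquot] at h1
      linarith
    have h4 := hg φ (controllerInput hout fhat k φ)
    -- Fed with the controller input of the same state, the open loop is definitionally the closed
    -- loop.
    change driverDeriv V₂ φ (closedLoop f hout fhat k φ) = _ at h4
    rw [h4, EReal.coe_le_coe_iff] at h3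
    change fderiv ℝ V₁ (φ (zeroPt Δ)) (closedLoop f hout fhat k φ) + _ ≤ _
    linarith
  · set e := c - (fderiv ℝ V₁ (φ (zeroPt Δ)) (sampledField f hout fhat k (φ, ψ)) +
      g (φ, controllerInput hout fhat k ψ)) with he
    have he0 : 0 < e := sub_pos.2 hc
    have h1 := eventually_lt_of_driverDeriv_le (hg φ (controllerInput hout fhat k ψ)).le
      (lt_add_of_pos_right _ (half_pos he0))
    have h2 := (tendsto_driver_of_differentiable hdiff φ
      (sampledField f hout fhat k (φ, ψ))).eventually_lt_const
        (lt_add_of_pos_right _ (half_pos he0))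
    filter_upwards [h1, h2] with h h1 h2
    rw [hquot]
    change (V₂ (driverShift φ h (sampledField f hout fhat k (φ, ψ))) - V₂ φ) / h < _ at h1
    linarith

end Lyapunov

/-! ### Absolutely continuous histories with bounded derivative -/

section AbsCont

theorem _root_.LipschitzWith.comp_absolutelyContinuousOnInterval {F G : Type}
    [PseudoMetricSpace F] [PseudoMetricSpace G] {g : F → G} (hg : LipschitzWith 1 g) {x : ℝ → F}
    {a b : ℝ} (hx : AbsolutelyContinuousOnInterval x a b) :
    AbsolutelyContinuousOnInterval (fun s => g (x s)) a b := by
  rw [absolutelyContinuousOnInterval_iff] at hx ⊢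
  intro ε hε
  obtain ⟨δ, hδ, h⟩ := hx ε hε
  refine ⟨δ, hδ, fun I hI hIδ => (Finset.sum_le_sum fun i _ => ?_).trans_lt (h I hI hIδ)⟩
  simpa using hg.dist_le_mul (x (I.2 i).1) (x (I.2 i).2)

/-- The fundamental theorem of calculus is applied to each coordinate, and the Euclidean norm is
bounded by the sum of coordinates, whence the factor `n`. Any constant depending only on `n` and `L`
would serve. -/
theorem norm_sub_le_of_absolutelyContinuous {n : ℕ} {x : ℝ → Eu n} {a b L : ℝ} (hab : a ≤ b)
    (hx : AbsolutelyContinuousOnInterval x a b)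
    (hL : ∀ᵐ s ∂(volume.restrict (Icc a b)), ‖deriv x s‖ ≤ L) :
    ‖x b - x a‖ ≤ n * L * (b - a) := by
  have hcomp : ∀ i, AbsolutelyContinuousOnInterval (fun s => x s i) a b := fun i =>
    LipschitzWith.comp_absolutelyContinuousOnInterval
      (g := fun v : Eu n => v i) (LipschitzWith.mk_one fun v w => by
        rw [dist_eq_norm, dist_eq_norm]
        exact PiLp.norm_apply_le (v - w) i) hx
  -- Where `x` is not differentiable `deriv x` is 0 and says nothing about the coordinates, so
  -- almost everywhere differentiability of `x` itself is required.
  have hdiff : ∀ᵐ s, s ∈ uIcc a b → DifferentiableAt ℝ x s := by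
    have : ∀ᵐ s, ∀ i, s ∈ uIcc a b → DifferentiableAt ℝ (fun s => x s i) s :=
      ae_all_iff.2 fun i => (hcomp i).ae_differentiableAt
    filter_upwards [this] with s hs hm
    exact differentiableAt_euclidean.2 fun i => hs i hm
  have hi : ∀ i, ‖x b i - x a i‖ ≤ L * (b - a) := by
    intro i
    rw [← (hcomp i).integral_deriv_eq_sub, ← abs_of_nonneg (sub_nonneg.2 hab)]
    refine intervalIntegral.norm_integral_le_of_norm_le_const_ae ?_
    rw [ae_restrict_iff' measurableSet_Icc] at hL
    filter_upwards [hL, hdiff] with s h1 h2 hs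
    rw [uIoc_of_le hab] at hs
    have hs' : s ∈ Icc a b := ⟨hs.1.le, hs.2⟩
    have h3 := (h2 (by rwa [uIcc_of_le hab])).hasDerivAt
    have h4 : HasDerivAt (fun s => x s i) (deriv x s i) s :=
      (EuclideanSpace.proj (𝕜 := ℝ) i : Eu n →L[ℝ] ℝ).hasFDerivAt.comp_hasDerivAt s h3
    rw [h4.deriv]
    exact (PiLp.norm_apply_le _ i).trans (h1 hs')
  have h1 : ‖x b - x a‖ ≤ ∑ i, ‖(x b - x a) i‖ := by
    refine le_of_sq_le_sq ?_ (Finset.sum_nonneg fun _ _ => norm_nonneg _)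
    rw [EuclideanSpace.norm_sq_eq]
    exact Finset.sum_sq_le_sq_sum_of_nonneg fun _ _ => norm_nonneg _
  refine h1.trans ((Finset.sum_le_sum fun i _ => hi i).trans (le_of_eq ?_))
  simp [mul_assoc]

theorem W1InftyBound.lipschitzWith {Δ : ℝ} [Fact (0 < Δ)] {n : ℕ} {φ : Hist Δ (Eu n)} {L : NNReal}
    (h : W1InftyBound φ L) : LipschitzWith (n * L) φ := by
  have key : ∀ a b : Icc (-Δ) (0 : ℝ), a ≤ b → dist (φ a) (φ b) ≤ n * L * dist a b := by
    intro a b hab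
    have hab' : (a : ℝ) ≤ b := hab
    have hsub : Icc (a : ℝ) b ⊆ Icc (-Δ) 0 := Icc_subset_Icc a.2.1 b.2.2
    have h1 := norm_sub_le_of_absolutelyContinuous hab'
      (h.1.mono (by rw [uIcc_of_le hab', uIcc_of_le (factLe Δ).out]; exact hsub))
      (ae_mono (Measure.restrict_mono hsub le_rfl) h.2)
    rw [IccExtendCM_coe, IccExtendCM_coe] at h1
    rw [dist_comm, dist_eq_norm, dist_comm, Subtype.dist_eq, Real.dist_eq,
      abs_of_nonneg (sub_nonneg.2 hab')]
    exact h1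
  refine LipschitzWith.of_dist_le_mul fun a b => ?_
  push_cast
  rcases le_total a b with hab | hab
  · exact key a b hab
  · rw [dist_comm, dist_comm a]
    exact key b a hab

theorem W1InftyBound.lipschitzWith_pairHist {Δ : ℝ} [Fact (0 < Δ)] {n : ℕ}
    {φ ψ : Hist Δ (Eu n)} {L : NNReal} (hφ : W1InftyBound φ L) (hψ : W1InftyBound ψ L) :
    LipschitzWith (2 * (n * L)) (pairHist φ ψ) := by
  have := lipschitzWith_stack.comp (hφ.lipschitzWith.prodMk hψ.lipschitzWith)
  rwa [max_self] at this

end AbsCont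

/-! ### Sampled-data solutions and the integral equation -/

section Interp

variable {Δ : ℝ} [Fact (0 < Δ)] {n : ℕ} {a δ : ℝ} {t : ℕ → ℝ}

theorem interp_of_nonpos (t : ℕ → ℝ) (φ : Hist Δ (Eu n)) (z : ℕ → Eu n) {s : ℝ} (hs : s ≤ 0) :
    interp t φ z s = ContinuousMap.IccExtendCM φ s := if_pos hs

/-- The formula survives at the endpoints: at `t (j + 1)` the index jumps but both formulas give `z
(j + 1)`, and at 0 the branch of the initial history agrees because of `hz`. -/
theorem IsPartition.interp_eq (ht : IsPartition a δ t) {φ : Hist Δ (Eu n)} {z : ℕ → Eu n}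
    (hz : z 0 = φ (zeroPt Δ)) {j : ℕ} {s : ℝ} (h1 : t j ≤ s) (h2 : s ≤ t (j + 1)) :
    interp t φ z s = z j + ((s - t j) / (t (j + 1) - t j)) • (z (j + 1) - z j) := by
  have hpos : 0 < t (j + 1) - t j := sub_pos.2 (ht.strictMono j.lt_succ_self)
  rcases le_or_gt s 0 with hs | hs
  · have hj : t j = 0 := le_antisymm (h1.trans hs) (ht.nonneg j)
    have hs0 : s = 0 := le_antisymm hs (hj ▸ h1)
    have hj0 : j = 0 := ht.strictMono.injective (hj.trans ht.zero.symm)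
    subst hs0
    subst hj0
    rw [interp_of_nonpos _ _ _ le_rfl, IccExtendCM_of_nonneg φ le_rfl, hj, sub_zero, zero_div,
      zero_smul, add_zero, hz]
  · rw [interp, if_neg (not_le.2 hs)]
    change z (lastIdx t s) + ((s - t (lastIdx t s)) / (t (lastIdx t s + 1) - t (lastIdx t s))) •
      (z (lastIdx t s + 1) - z (lastIdx t s)) = _
    rcases h2.lt_or_eq with h3 | h3
    · rw [ht.lastIdx_eq h1 h3]
    · rw [h3, ht.lastIdx_sample, sub_self, zero_div, zero_smul, div_self hpos.ne']
      module

theorem IsPartition.interp_sample (ht : IsPartition a δ t) {φ : Hist Δ (Eu n)} {z : ℕ → Eu n}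
    (hz : z 0 = φ (zeroPt Δ)) (j : ℕ) : interp t φ z (t j) = z j := by
  rw [ht.interp_eq hz le_rfl (ht.strictMono j.lt_succ_self).le, sub_self, zero_div, zero_smul,
    add_zero]

theorem IsPartition.continuous_interp (ht : IsPartition a δ t) {φ : Hist Δ (Eu n)} {z : ℕ → Eu n}
    (hz : z 0 = φ (zeroPt Δ)) : Continuous (interp t φ z) := by
  have hneg : ContinuousOn (interp t φ z) (Iic 0) :=
    (ContinuousMap.IccExtendCM φ).continuous.continuousOn.congr fun s hs =>
      interp_of_nonpos t φ z hs
  have hpiece : ∀ j, ContinuousOn (interp t φ z) (Icc (t j) (t (j + 1))) := fun j => by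
    have : ContinuousOn
        (fun s => z j + ((s - t j) / (t (j + 1) - t j)) • (z (j + 1) - z j))
        (Icc (t j) (t (j + 1))) := by fun_prop
    exact this.congr fun s hs => ht.interp_eq hz hs.1 hs.2
  have hall : ∀ j, ContinuousOn (interp t φ z) (Iic (t j)) := fun j => by
    induction j with
    | zero => rwa [ht.zero]
    | succ j ih =>
      rw [← Iic_union_Icc_eq_Iic (ht.strictMono j.lt_succ_self).le]
      exact ih.union_of_isClosed (hpiece j) isClosed_Iic isClosed_Icc
  refine continuous_iff_continuousAt.2 fun s => ?_
  obtain ⟨j, hj⟩ := (ht.tendsto.eventually_gt_atTop s).exists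
  exact (hall j).continuousAt (Iic_mem_nhds hj)

/-- Euler steps become an integral equation: a piecewise linear interpolant is the primitive of its
piecewise constant slope. -/
theorem IsPartition.integral_piecewise_const (ht : IsPartition a δ t) {g : ℝ → Eu n} {c : ℝ}
    (hgi : ∀ b c, IntervalIntegrable g volume b c) {φ : Hist Δ (Eu n)} {z : ℕ → Eu n}
    (hz : z 0 = φ (zeroPt Δ))
    (hg : ∀ j u, t j ≤ u → u < t (j + 1) → u ≤ c →
      z (j + 1) - z j = (t (j + 1) - t j) • g u) :
    ∀ s ∈ Icc 0 c, interp t φ z s = z 0 + ∫ u in (0 : ℝ)..s, g u := by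
  have step : ∀ j s, t j ≤ s → s ≤ t (j + 1) → s ≤ c →
      interp t φ z s = z j + ∫ u in (t j)..s, g u := by
    intro j s h1 h2 h3
    have hpos : 0 < t (j + 1) - t j := sub_pos.2 (ht.strictMono j.lt_succ_self)
    have hgc : ∀ u, t j ≤ u → u < t (j + 1) → u ≤ c →
        g u = (t (j + 1) - t j)⁻¹ • (z (j + 1) - z j) := fun u h4 h5 h6 => by
      rw [hg j u h4 h5 h6, smul_smul, inv_mul_cancel₀ hpos.ne', one_smul]
    have : ∫ u in (t j)..s, g u =
        ∫ u in (t j)..s, (t (j + 1) - t j)⁻¹ • (z (j + 1) - z j) := by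
      refine intervalIntegral.integral_congr_uIoo ?_
      intro u hu
      rw [uIoo_of_le h1] at hu
      exact hgc u hu.1.le (hu.2.trans_le h2) (hu.2.le.trans h3)
    rw [this, intervalIntegral.integral_const, ht.interp_eq hz h1 h2, smul_smul, div_eq_mul_inv]
  have hsamp : ∀ j, t j ≤ c → z j = z 0 + ∫ u in (0 : ℝ)..(t j), g u := by
    intro j
    induction j with
    | zero => simp [ht.zero]
    | succ j ih =>
      intro hc
      have hle := (ht.strictMono j.lt_succ_self).le
      have h1 := step j (t (j + 1)) hle le_rfl hc
      rw [ht.interp_sample hz, ih (hle.trans hc), add_assoc,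
        intervalIntegral.integral_add_adjacent_intervals (hgi _ _) (hgi _ _)] at h1
      exact h1
  intro s hs
  obtain ⟨j, hj, hj'⟩ := ht.exists_mem_Ico hs.1
  rw [step j s hj hj'.le hs.2, hsamp j (hj.trans hs.2), add_assoc,
    intervalIntegral.integral_add_adjacent_intervals (hgi _ _) (hgi _ _)]

end Interp

/-! ### Derivatives and bounds of the sampled integral -/

section SampledIntegral

variable {Δ a δ : ℝ} {t : ℕ → ℝ} {E : Type} [NormedAddCommGroup E]

theorem _root_.IntervalIntegrable.clm_comp {F G : Type} [NormedAddCommGroup F] [NormedSpace ℝ F]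
    [NormedAddCommGroup G] [NormedSpace ℝ G] {g : ℝ → F} {b c : ℝ}
    (hg : IntervalIntegrable g volume b c) (T : F →L[ℝ] G) :
    IntervalIntegrable (fun u => T (g u)) volume b c :=
  ⟨T.integrable_comp hg.1, T.integrable_comp hg.2⟩

theorem ae_notMem_range (t : ℕ → ℝ) : ∀ᵐ s : ℝ, s ∉ range t :=
  (countable_range t).ae_notMem volume

theorem IsPartition.hasDerivAt_integral_sampled [NormedSpace ℝ E] [CompleteSpace E]
    (ht : IsPartition a δ t) {A : Hist Δ E × Hist Δ E → E} (hA : Continuous A)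
    {X : ℝ → E} (hX : Continuous X)
    (hgi : ∀ b c,
      IntervalIntegrable (fun u => A (hist Δ X u, hist Δ X (lastSample t u))) volume b c)
    {j : ℕ} {s : ℝ} (hs : s ∈ Ico (t j) (t (j + 1))) (hst : s ∉ range t) :
    HasDerivAt (fun s => ∫ u in (0 : ℝ)..s, A (hist Δ X u, hist Δ X (lastSample t u)))
      (A (hist Δ X s, hist Δ X (t j))) s := by
  have hlt : t j < s := lt_of_le_of_ne hs.1 fun h => hst ⟨j, h⟩
  have hc : ContinuousAt (fun u => A (hist Δ X u, hist Δ X (lastSample t u))) s := by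
    rw [← continuousWithinAt_univ]
    refine continuousWithinAt_sampled hA hX ?_
    rw [nhdsWithin_univ]
    filter_upwards [Ioo_mem_nhds hlt hs.2] with u hu
    rw [ht.lastSample_eq hu.1.le hu.2, ht.lastSample_eq hs.1 hs.2]
  have h1 := intervalIntegral.integral_hasDerivAt_right (hgi 0 s)
    (stronglyMeasurable_sampled hA ht.isSampler.measurable hX).stronglyMeasurableAtFilter hc
  rwa [ht.lastSample_eq hs.1 hs.2] at h1

theorem LipschitzOnBounded.exists_sampled_bound {A : Hist Δ E × Hist Δ E → E}
    (hA : LipschitzOnBounded A) {X : ℝ → E} (hX : Continuous X)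
    {B : ℝ} (hB : ∀ s, ‖X s‖ ≤ B) (σ : ℝ → ℝ) :
    ∃ M : NNReal, ∀ u, ‖A (hist Δ X u, hist Δ X (σ u))‖ ≤ M := by
  obtain ⟨M, hM0, hM⟩ := (hA.isBounded_image
    (Metric.isBounded_closedBall (x := (0 : Hist Δ E × Hist Δ E)) (r := B))).exists_pos_norm_le
  have hB0 : 0 ≤ B := (norm_nonneg _).trans (hB 0)
  have hh : ∀ u, ‖hist Δ X u‖ ≤ B := fun u => norm_hist_le hX hB0 fun v _ => hB v
  lift M to NNReal using hM0.le
  refine ⟨M, fun u => hM _ (mem_image_of_mem A ?_)⟩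
  rw [mem_closedBall_zero_iff]
  exact max_le (hh u) (hh (σ u))

end SampledIntegral

/-! ### Equivalence of the sampled-data loop with the integral equation -/

section Translation

variable {Δ : ℝ} [Fact (0 < Δ)] {n m q : ℕ} {f : Hist Δ (Eu n) × Eu m → Eu n}
    {hout : Hist Δ (Eu n) → Eu q} {fhat : Hist Δ (Eu n) × Eu m × Eu q → Eu n}
    {k : Hist Δ (Eu n) × Eu q → Eu m} {a δ : ℝ} {t : ℕ → ℝ}

theorem IsSampledSolution.exists_integral_eq (ht : IsPartition a δ t)
    (hA : LipschitzOnBounded (sampledField f hout fhat k)) {x₀ xhat₀ : Hist Δ (Eu n)} {b : EReal}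
    {x : ℝ → Eu n} {z : ℕ → Eu n} (h : IsSampledSolution f hout fhat k t x₀ xhat₀ b x z) {c : ℝ}
    (hc : 0 ≤ c) (hcb : (c : EReal) < b) :
    ∃ Y : ℝ → Eu2 n, Continuous Y ∧
      (∀ s ∈ Icc (-Δ) c, Y s = stack (x s) (interp t xhat₀ z s)) ∧
      ∀ s ∈ Icc 0 c, Y s = Y 0 + ∫ u in (0 : ℝ)..s,
        sampledField f hout fhat k (hist Δ Y u, hist Δ Y (lastSample t u)) := by
  have hΔ : 0 < Δ := Fact.out
  have hltb : ∀ s, s ≤ c → (s : EReal) < b := fun s hs =>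
    (EReal.coe_le_coe_iff.2 hs).trans_lt hcb
  have hcont : ContinuousOn (fun s => stack (x s) (interp t xhat₀ z s)) (Icc (-Δ) c) :=
    lipschitzWith_stack.continuous.comp_continuousOn
      ((h.cont.mono fun s hs => ⟨hs.1, hltb s hs.2⟩).prodMk
        (ht.continuous_interp h.obs_init).continuousOn)
  -- Freezing time outside `[-Δ, c]` yields a bounded continuous function on the line, since `x` is
  -- controlled only on `[-Δ, b)`.
  let Y : ℝ → Eu2 n := fun s => stack (x (max (-Δ) (min s c)))
    (interp t xhat₀ z (max (-Δ) (min s c)))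
  have hclamp : ∀ s, max (-Δ) (min s c) ∈ Icc (-Δ) c := fun s =>
    ⟨le_max_left _ _, max_le (by linarith) (min_le_right _ _)⟩
  have hY : Continuous Y :=
    hcont.comp_continuous (f := fun s => max (-Δ) (min s c)) (by fun_prop) hclamp
  have hYe : ∀ s ∈ Icc (-Δ) c, Y s = stack (x s) (interp t xhat₀ z s) := fun s hs => by
    simp only [Y, min_eq_left hs.2, max_eq_right hs.1]
  obtain ⟨B, hB⟩ : ∃ B, ∀ s, ‖Y s‖ ≤ B := by
    obtain ⟨B, hB⟩ := isCompact_Icc.exists_bound_of_continuousOn hcont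
    exact ⟨B, fun s => hB _ (hclamp s)⟩
  obtain ⟨M, hM⟩ := hA.exists_sampled_bound hY hB (lastSample t)
  have hgi := intervalIntegrable_sampled hA.continuous ht.isSampler.measurable hY hM
  set g := fun u => sampledField f hout fhat k (hist Δ Y u, hist Δ Y (lastSample t u)) with hg_def
  have hfst : ∀ u ∈ Icc 0 c, fstHist (hist Δ Y u) = hist Δ x u := fun u hu => by
    rw [fstHist_hist hY]
    refine hist_congr ((topCLM n).continuous.comp hY).continuousOn fun v hv => ?_
    simp only [hYe v ⟨by linarith [hu.1, hv.1], hv.2.trans hu.2⟩, topBlock_stack]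
  have hsnd : ∀ j, t j ≤ c → sndHist (hist Δ Y (t j)) = obsHist t xhat₀ z j := fun j hj => by
    rw [sndHist_hist hY, obsHist]
    refine hist_congr ((botCLM n).continuous.comp hY).continuousOn fun v hv => ?_
    simp only [hYe v ⟨by linarith [ht.nonneg j, hv.1], hv.2.trans hj⟩, botBlock_stack]
  have hfield : ∀ j u, t j ≤ u → u ≤ c → sampledField f hout fhat k (hist Δ Y u, hist Δ Y (t j)) =
      stack (f (hist Δ x u, k (obsHist t xhat₀ z j, hout (hist Δ x (t j)))))
        (fhat (obsHist t xhat₀ z j, k (obsHist t xhat₀ z j, hout (hist Δ x (t j))),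
          hout (hist Δ x (t j)))) := fun j u hj hu => by
    simp only [sampledField, openLoop, controllerInput, hsnd j (hj.trans hu),
      hfst u ⟨(ht.nonneg j).trans hj, hu⟩, hfst (t j) ⟨ht.nonneg j, hj.trans hu⟩]
  have hbot : ∀ s ∈ Icc 0 c, interp t xhat₀ z s = z 0 + ∫ u in (0 : ℝ)..s, botCLM n (g u) := by
    refine ht.integral_piecewise_const (fun b c => (hgi b c).clm_comp (botCLM n))
      h.obs_init fun j u h1 h2 h3 => ?_
    rw [hg_def]
    simp only
    rw [ht.lastSample_eq h1 h2, hfield j u h1 h3, botCLM_apply, botBlock_stack,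
      h.euler j (hltb _ (h1.trans h3)), add_sub_cancel_left]
  -- The ODE holds only almost everywhere; absolute continuity makes the difference of `x` and the
  -- integral constant.
  have htop : ∀ s ∈ Icc 0 c, x s = x 0 + ∫ u in (0 : ℝ)..s, topCLM n (g u) := by
    have hder : ∀ᵐ s, s ∈ uIcc 0 c →
        HasDerivAt (fun s => x s - topCLM n (∫ u in (0 : ℝ)..s, g u)) 0 s := by
      filter_upwards [ae_all_iff.2 h.ode, ae_notMem_range t] with s h1 h2 hs
      rw [uIcc_of_le hc] at hs
      obtain ⟨j, hj⟩ := ht.exists_mem_Ico hs.1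
      have h3 := h1 j hj (hltb s hs.2)
      have h4 := (topCLM n).hasFDerivAt.comp_hasDerivAt s
        (ht.hasDerivAt_integral_sampled hA.continuous hY hgi hj h2)
      rw [hfield j s hj.1 hs.2, topCLM_apply, topBlock_stack] at h4
      have h5 := h3.sub h4
      rw [sub_self] at h5
      exact h5
    have hac : AbsolutelyContinuousOnInterval
        (fun s => x s - topCLM n (∫ u in (0 : ℝ)..s, g u)) 0 c :=
      (h.abs_cont c hc hcb).sub (((topCLM n).lipschitz.comp
        (lipschitzWith_primitive hM hgi)).lipschitzOnWith.absolutelyContinuousOnInterval)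
    obtain ⟨C, hC⟩ := hac.const_of_ae_hasDerivAt_zero hder
    intro s hs
    have h1 := hC s (by rwa [uIcc_of_le hc])
    have h2 := hC 0 left_mem_uIcc
    rw [intervalIntegral.integral_same, map_zero, sub_zero] at h2
    rw [(topCLM n).intervalIntegral_comp_comm (hgi _ _), h2, ← h1]
    abel
  refine ⟨Y, hY, hYe, fun s hs => ?_⟩
  have h0 := hYe 0 ⟨by linarith, hc⟩
  have hz0 : interp t xhat₀ z 0 = z 0 := by
    have := ht.interp_sample h.obs_init 0
    rwa [ht.zero] at this
  rw [← stack_blocks (Y 0 + _), ← topCLM_apply, ← botCLM_apply, map_add, map_add, topCLM_apply,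
    botCLM_apply, h0, topBlock_stack, botBlock_stack, hYe s ⟨by linarith [hs.1], hs.2⟩, htop s hs,
    hbot s hs, hz0, (topCLM n).intervalIntegral_comp_comm (hgi _ _),
    (botCLM n).intervalIntegral_comp_comm (hgi _ _)]

/-- The observer velocity is constant between samples, so integrating over one sampling interval is
an Euler step and the lower block of `X` is its own interpolant. The sampling times are countable,
so the plant equation may be checked away from them. -/
theorem isSampledSolution_of_integral_eq (ht : IsPartition a δ t)
    (hA : LipschitzOnBounded (sampledField f hout fhat k)) {x₀ xhat₀ : Hist Δ (Eu n)}
    {X : ℝ → Eu2 n} {L : NNReal} (hXL : LipschitzWith L X)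
    (hX₀ : ∀ θ : Icc (-Δ) (0 : ℝ), X θ = pairHist x₀ xhat₀ θ) {B : ℝ} (hB : ∀ s, ‖X s‖ ≤ B)
    (hXe : ∀ s, 0 ≤ s → X s = X 0 + ∫ u in (0 : ℝ)..s,
      sampledField f hout fhat k (hist Δ X u, hist Δ X (lastSample t u))) :
    (∀ s, -Δ ≤ s → interp t xhat₀ (fun j => botBlock (X (t j))) s = botBlock (X s)) ∧
    IsSampledSolution f hout fhat k t x₀ xhat₀ ⊤ (fun s => topBlock (X s))
      (fun j => botBlock (X (t j))) := by
  have hΔ : 0 < Δ := Fact.out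
  have hX := hXL.continuous
  obtain ⟨M, hM⟩ := hA.exists_sampled_bound hX hB (lastSample t)
  have hgi := intervalIntegrable_sampled hA.continuous ht.isSampler.measurable hX hM
  have hX0 : X 0 = stack (x₀ (zeroPt Δ)) (xhat₀ (zeroPt Δ)) := hX₀ (zeroPt Δ)
  have hz0 : botBlock (X (t 0)) = xhat₀ (zeroPt Δ) := by rw [ht.zero, hX0, botBlock_stack]
  set g := fun u => sampledField f hout fhat k (hist Δ X u, hist Δ X (lastSample t u)) with hg_def
  have hbotint : ∀ s, 0 ≤ s →
      botBlock (X s) = botBlock (X 0) + ∫ u in (0 : ℝ)..s, botCLM n (g u) := fun s hs => by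
    rw [(botCLM n).intervalIntegral_comp_comm (hgi _ _), ← botCLM_apply, ← botCLM_apply, ← map_add,
      ← hXe s hs]
  have hg : ∀ j u, t j ≤ u → u < t (j + 1) →
      botCLM n (g u) = (controllerInput hout fhat k (hist Δ X (t j))).2 := fun j u h1 h2 => by
    rw [hg_def]
    simp only
    rw [ht.lastSample_eq h1 h2]
    rfl
  have hstep : ∀ j, botBlock (X (t (j + 1))) = botBlock (X (t j)) +
      (t (j + 1) - t j) • (controllerInput hout fhat k (hist Δ X (t j))).2 := fun j => by
    have hle := (ht.strictMono j.lt_succ_self).le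
    have h1 : ∫ u in (t j)..(t (j + 1)), botCLM n (g u) =
        (t (j + 1) - t j) • (controllerInput hout fhat k (hist Δ X (t j))).2 := by
      rw [← intervalIntegral.integral_const]
      refine intervalIntegral.integral_congr_uIoo fun u hu => ?_
      rw [uIoo_of_le hle] at hu
      exact hg j u hu.1.le hu.2
    rw [hbotint _ (ht.nonneg (j + 1)), hbotint _ (ht.nonneg j), ← h1, add_assoc,
      intervalIntegral.integral_add_adjacent_intervals
        ((hgi _ _).clm_comp (botCLM n))
        ((hgi _ _).clm_comp (botCLM n))]
  have hinterp : ∀ s, -Δ ≤ s →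
      interp t xhat₀ (fun j => botBlock (X (t j))) s = botBlock (X s) := by
    intro s hs
    rcases le_total s 0 with h | h
    · have h1 := hX₀ ⟨s, hs, h⟩
      simp only at h1
      rw [interp_of_nonpos _ _ _ h, ContinuousMap.IccExtendCM_of_mem ⟨hs, h⟩, h1]
      rfl
    · rw [hbotint s h, ht.integral_piecewise_const (c := s)
        (fun b c => (hgi b c).clm_comp (botCLM n)) hz0 (fun j u h1 h2 _ => by
          rw [hstep j, hg j u h1 h2, add_sub_cancel_left]) s ⟨h, le_rfl⟩, ht.zero]
  have hobs : ∀ j, obsHist t xhat₀ (fun j => botBlock (X (t j))) j = sndHist (hist Δ X (t j)) := by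
    intro j
    rw [sndHist_hist hX, obsHist]
    exact (hist_congr ((botCLM n).continuous.comp hX).continuousOn fun v hv =>
      (hinterp v (by linarith [hv.1, ht.nonneg j])).symm).symm
  refine ⟨hinterp, ⟨fun θ => ?_, hz0, ((topCLM n).continuous.comp hX).continuousOn,
    fun c _ _ => ((topCLM n).lipschitz.comp hXL).lipschitzOnWith.absolutelyContinuousOnInterval,
    fun j => ?_, fun j _ => ?_⟩⟩
  · simp only [hX₀ θ]
    rfl
  · filter_upwards [ae_notMem_range t] with s h1 hs _
    have h2 := (ht.hasDerivAt_integral_sampled hA.continuous hX hgi hs h1).const_add (X 0)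
    have hs0 : 0 < s := lt_of_le_of_ne ((ht.nonneg j).trans hs.1)
      fun h => h1 ⟨0, ht.zero.trans h⟩
    have h3 : HasDerivAt X (sampledField f hout fhat k (hist Δ X s, hist Δ X (t j))) s := by
      refine h2.congr_of_eventuallyEq ?_
      filter_upwards [Ioi_mem_nhds hs0] with u hu
      exact hXe u hu.le
    have h4 := (topCLM n).hasFDerivAt.comp_hasDerivAt s h3
    rw [hobs j, ← fstHist_hist hX, ← fstHist_hist hX]
    exact h4
  · rw [hobs j, ← fstHist_hist hX]
    exact hstep j

end Translation

theorem IsSampledSolution.eq_of_integral_eq {Δ : ℝ} [Fact (0 < Δ)] {n m q : ℕ}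
    {f : Hist Δ (Eu n) × Eu m → Eu n} {hout : Hist Δ (Eu n) → Eu q}
    {fhat : Hist Δ (Eu n) × Eu m × Eu q → Eu n} {k : Hist Δ (Eu n) × Eu q → Eu m} {a δ : ℝ}
    {t : ℕ → ℝ} (ht : IsPartition a δ t) (hA : LipschitzOnBounded (sampledField f hout fhat k))
    {x₀ xhat₀ : Hist Δ (Eu n)} {b : EReal} {x : ℝ → Eu n} {z : ℕ → Eu n}
    (h : IsSampledSolution f hout fhat k t x₀ xhat₀ b x z) {X : ℝ → Eu2 n} (hX : Continuous X)
    (hX₀ : ∀ θ : Icc (-Δ) (0 : ℝ), X θ = pairHist x₀ xhat₀ θ)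
    (hXe : ∀ s, 0 ≤ s → X s = X 0 + ∫ u in (0 : ℝ)..s,
      sampledField f hout fhat k (hist Δ X u, hist Δ X (lastSample t u))) {c : ℝ}
    (hc : 0 ≤ c) (hcb : (c : EReal) < b) :
    ∀ s ∈ Icc (-Δ) c, X s = stack (x s) (interp t xhat₀ z s) := by
  obtain ⟨Y, hY, hYs, hYe⟩ := h.exists_integral_eq ht hA hc hcb
  have h0 : ∀ s ∈ Icc (-Δ) 0, X s = Y s := fun s hs => by
    have h1 := hX₀ ⟨s, hs⟩
    have h2 := h.init ⟨s, hs⟩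
    simp only at h1 h2
    rw [hYs s ⟨hs.1, hs.2.trans hc⟩, interp_of_nonpos _ _ _ hs.2,
      ContinuousMap.IccExtendCM_of_mem hs, h1, h2]
    rfl
  have h00 : X 0 = Y 0 := h0 0 (zeroPt Δ).2
  intro s hs
  rw [← hYs s hs]
  exact sampled_volterra_unique_of_lipschitzOnBounded hA ht.isSampler hX hY hc h0
    (fun s hs => hXe s hs.1) (fun s hs => by rw [h00]; exact hYe s hs) s hs

end EulerEmulation

/-! ### Existence, uniqueness and practical stability of the sampled-data loop -/

theorem theorem1 (Δ : ℝ) [Fact (0 < Δ)] (n m q : ℕ) (hn : 0 < n) (hm : 0 < m) (hq : 0 < q)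
    (f : EulerEmulation.Hist Δ (EulerEmulation.Eu n) × EulerEmulation.Eu m → EulerEmulation.Eu n)
    (hout : EulerEmulation.Hist Δ (EulerEmulation.Eu n) → EulerEmulation.Eu q)
    (fhat : EulerEmulation.Hist Δ (EulerEmulation.Eu n) ×
      EulerEmulation.Eu m × EulerEmulation.Eu q → EulerEmulation.Eu n)
    (k : EulerEmulation.Hist Δ (EulerEmulation.Eu n) × EulerEmulation.Eu q → EulerEmulation.Eu m)
    (hf : EulerEmulation.LipschitzOnBounded f) (hf0 : f 0 = 0)
    (hh : EulerEmulation.LipschitzOnBounded hout) (hh0 : hout 0 = 0)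
    (hfhat : EulerEmulation.LipschitzOnBounded fhat) (hfhat0 : fhat 0 = 0)
    (hk : EulerEmulation.LipschitzOnBounded k) (hk0 : k 0 = 0)
    (hV : EulerEmulation.LyapunovAssumption f hout fhat k)
    (qtilde : ℝ) (hqtilde : 0 < qtilde)
    (a : ℝ) (ha0 : 0 < a) (ha1 : a ≤ 1)
    (R r : ℝ) (hr : 0 < r) (hrR : r < R) :
    ∃ δ T E : ℝ, 0 < δ ∧ 0 < T ∧ 0 < E ∧
      ∀ t : ℕ → ℝ, EulerEmulation.IsPartition a δ t →
      ∀ x₀ xhat₀ : EulerEmulation.Hist Δ (EulerEmulation.Eu n),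
        EulerEmulation.W1InftyBound x₀ (qtilde / √2) →
        EulerEmulation.W1InftyBound xhat₀ (qtilde / √2) →
        ‖EulerEmulation.pairHist x₀ xhat₀‖ ≤ R →
        ∃ (x : ℝ → EulerEmulation.Eu n) (z : ℕ → EulerEmulation.Eu n),
          -- the solution exists on the whole of `[0, ∞)`
          EulerEmulation.IsSampledSolution f hout fhat k t x₀ xhat₀ ⊤ x z ∧
          -- it is the solution: every solution, on any interval `[0, b)`, is a restriction of it
          (∀ (b : EReal) (x' : ℝ → EulerEmulation.Eu n) (z' : ℕ → EulerEmulation.Eu n), 0 < b →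
            EulerEmulation.IsSampledSolution f hout fhat k t x₀ xhat₀ b x' z' →
            (∀ s : ℝ, -Δ ≤ s → (s : EReal) < b → x' s = x s) ∧
            (∀ j : ℕ, (t j : EReal) < b → z' j = z j)) ∧
          -- it stays in the ball of radius `E`
          (∀ s : ℝ, 0 ≤ s → ∀ j : ℕ,
            ‖EulerEmulation.pairHist (EulerEmulation.hist Δ x s)
              (EulerEmulation.obsHist t xhat₀ z j)‖ ≤ E) ∧
          -- it is in the ball of radius `r` after time `T`
          (∀ s : ℝ, T ≤ s → ∀ j : ℕ, T ≤ t j →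
            ‖EulerEmulation.pairHist (EulerEmulation.hist Δ x s)
              (EulerEmulation.obsHist t xhat₀ z j)‖ ≤ r) := by
  open EulerEmulation in
  have hΔ : 0 < Δ := Fact.out
  have hA := lipschitzOnBounded_sampledField hf hh hfhat hk
  obtain ⟨V, G, α, γ₁, γ₂, hVL, hG, hα, hGα, hdrv, hγ₁, hγ₂, hγ⟩ :=
    hV.exists_functional hf hh hfhat hk
  obtain ⟨L₀, hL₀⟩ : ∃ L₀ : NNReal, (L₀ : ℝ) = qtilde / √2 :=
    ⟨⟨qtilde / √2, by positivity⟩, rfl⟩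
  rw [← hL₀]
  -- The two blocks are evaluated at unrelated times `s` and `t j`, so the norm of the pair is
  -- bounded by the sum of the two norms; hence the radius `r / 2` here and the bound `ρ + ρ` below.
  obtain ⟨δ, T, ρ, hδ, hT, hρ, H⟩ := exists_sampled_practical_stability hA hVL hG hα hGα hdrv hγ₁
    hγ₂ hγ (2 * (n * L₀)) (hr.trans hrR) (half_pos hr)
  -- A history reaches back by `Δ`, so the whole of it is small only from `T + Δ` on.
  refine ⟨δ, T + Δ, ρ + ρ, hδ, by positivity, by positivity, fun t ht x₀ xhat₀ hx₀ hxhat₀ hR => ?_⟩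
  obtain ⟨X, L, hXL, hX₀, hXe, hXρ, hXr⟩ := H (lastSample t) ht.isSampler (pairHist x₀ xhat₀)
    (hx₀.lipschitzWith_pairHist hxhat₀) hR
  obtain ⟨hint, hsol⟩ := isSampledSolution_of_integral_eq ht hA hXL hX₀ hXρ hXe
  have hXc := hXL.continuous
  have hobs : ∀ j, obsHist t xhat₀ (fun j => botBlock (X (t j))) j =
      hist Δ (fun s => botBlock (X s)) (t j) := fun j =>
    (hist_congr ((botCLM n).continuous.comp hXc).continuousOn fun v hv =>
      (hint v (by linarith [hv.1, ht.nonneg j])).symm).symm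
  have hpair : ∀ s j B, 0 ≤ B → (∀ u ∈ Icc (s - Δ) s, ‖X u‖ ≤ B) →
      (∀ u ∈ Icc (t j - Δ) (t j), ‖X u‖ ≤ B) →
      ‖pairHist (hist Δ (fun s => topBlock (X s)) s)
        (obsHist t xhat₀ (fun j => botBlock (X (t j))) j)‖ ≤ B + B := by
    intro s j B hB h1 h2
    rw [hobs j]
    refine (norm_pairHist_le _ _).trans (add_le_add ?_ ?_)
    · exact norm_hist_le ((topCLM n).continuous.comp hXc) hB fun u hu =>
        (norm_topBlock_le _).trans (h1 u hu)
    · exact norm_hist_le ((botCLM n).continuous.comp hXc) hB fun u hu =>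
        (norm_botBlock_le _).trans (h2 u hu)
  refine ⟨fun s => topBlock (X s), fun j => botBlock (X (t j)), hsol, ?_, ?_, ?_⟩
  · intro b x' z' hb hsol'
    have key : ∀ c : ℝ, 0 ≤ c → (c : EReal) < b → ∀ s ∈ Icc (-Δ) c,
        X s = stack (x' s) (interp t xhat₀ z' s) := fun c hc hcb =>
      hsol'.eq_of_integral_eq ht hA hXc hX₀ hXe hc hcb
    refine ⟨fun s hs hsb => ?_, fun j hj => ?_⟩
    · change x' s = topBlock (X s)
      rcases le_total s 0 with h | h
      · rw [key 0 le_rfl hb s ⟨hs, h⟩, topBlock_stack]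
      · rw [key s h hsb s ⟨hs, le_rfl⟩, topBlock_stack]
    · change z' j = botBlock (X (t j))
      rw [key (t j) (ht.nonneg j) hj (t j) ⟨by linarith [ht.nonneg j], le_rfl⟩, botBlock_stack,
        ht.interp_sample hsol'.obs_init]
  · intro s _ j
    exact hpair s j ρ hρ.le (fun u _ => hXρ u) fun u _ => hXρ u
  · intro s hs j hj
    rw [← add_halves r]
    exact hpair s j (r / 2) (half_pos hr).le (fun u hu => hXr u (by linarith [hu.1]))
      fun u hu => hXr u (by linarith [hu.1])
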